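/- Let $(\mathcal M,g)$ be a smooth (Hausdorff, finite-dimensional) Riemannian manifold. Write $C_c^\infty(\mathcal M)$ for the smooth compactly supported complex functions and $\Gamma_c(\mathcal M,V)$ for the smooth compactly supported sections of $V$. A *smooth deformation* of $\mathcal M$ consists of a commutative $\mathbb C$-algebra $K$, an element $\kappa\in K$, a (not necessarily unital) $K$-algebra $A$ and an isomorphism $A/\kappa A\cong C_c^\infty(\mathcal M)$ of $\mathbb C$-algebras, such that $A/\kappa^3A$ is a free $\mathbb C[\kappa]/\kappa^3$-module. Its *Poisson bracket* is defined by $\kappa\{f,h\}=i(ab-ba)\bmod\kappa^2$ for $f=a\bmod\kappa$, $h=b\bmod\kappa$. A *bimodule deformation* of a complex vector bundle $V$ is an $A$-bimodule $W$ (over $K$) with an isomorphism $W/\kappa W\cong\Gamma_c(\mathcal M,V)$ of $C_c^\infty(\mathcal M)$-bimodules, such that $W/\kappa^3W$ is a free $\mathbb C[\kappa]/\kappa^3$-module. A *deformed spectral triple* $(A,W,D)$ for $(\mathcal M,g)$ consists of a smooth deformation $A$ of $\mathcal M$, a bimodule deformation $W$ of a Spin bundle $V$ (a smooth complex vector bundle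 of finite nonzero rank with a smooth Clifford multiplication $c:T^*\mathcal M\to\operatorname{End}V$, $c(\alpha)c(\beta)+c(\beta)c(\alpha)=2g^{ij}\alpha_i\beta_j$), and a $K$-linear operator $D:W\to W$ such that 1. $D\bmod\kappa$ is a Dirac-type operator $D_0$ on $\Gamma_c(\mathcal M,V)$, i.e. a linear operator with $[D_0,f]=i\,c(df)$ for $f\in C_c^\infty(\mathcal M)$; 2. for every $a\in A$, $[D,a]$ commutes with the right multiplication of $A$ on $W$; 3. the $A$-bimodule $\Omega^1_D$ of operators on $W$ generated by the commutators $[D,a]$, $a\in A$, is (for a suitable identification modulo $\kappa$) a bimodule deformation of the complexified cotangent bundle, for which the derivation $d:A\to\Omega^1_D$, $da=-i[D,a]$, reduces modulo $\kappa$ to the gradient $d:C_c^\infty(\mathcal M)\to\Omega^1_c(\mathcal M)$. **Corollary.** Suppose that $(\mathcal M,g)$ admits a deformed spectral triple whose Poisson structure is (real and) symplectic: $\{f,h\}=\pi^{ij}\,\partial_if\,\partial_jh$ for a real bivector field $\pi$ that is inverse to a 2-form $\omega$ (necessarily closed, hence a symplectic form), $\pi^{ai}\omega_{aj}=\delta^i_j$.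 Then $$g'_{jk}:=\omega_{ja}\,\omega_{kb}\,g^{ab}$$ is a flat Riemannian metric on $\mathcal M$: it is smooth and positive definite, and the curvature of its Levi-Civita connection vanishes. -/

import Mathlib

open Bundle
open scoped Manifold ContDiff

noncomputable section

/-! ### Smooth manifolds, functions, sections, forms -/

/-- The real cotangent space `T*_x M`. -/
abbrev Cotangent (n : ℕ) {M : Type*} [TopologicalSpace M]
    [ChartedSpace (EuclideanSpace ℝ (Fin n)) M] (x : M) : Type :=
  TangentSpace (𝓡 n) x →L[ℝ] ℝ

/-- The fibre `T*_x M ⊗ ℂ` of the complexified cotangent bundle: real-linear maps `T_x M → ℂ`. -/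
abbrev CotangentC (n : ℕ) (M : Type*) [TopologicalSpace M]
    [ChartedSpace (EuclideanSpace ℝ (Fin n)) M] (x : M) : Type :=
  TangentSpace (𝓡 n) x →L[ℝ] (Trivial M ℂ x)

/-- `C_c^∞(M)`: smooth compactly supported complex-valued functions. -/
def testFunctions (n : ℕ) (M : Type*) [TopologicalSpace M]
    [ChartedSpace (EuclideanSpace ℝ (Fin n)) M] : Set (M → ℂ) :=
  {f | ContMDiff (𝓡 n) 𝓘(ℝ, ℂ) ∞ f ∧ HasCompactSupport f}

/-- A section of the bundle `V` (with model fibre `F`) is smooth. -/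
def IsSmoothSection (n : ℕ) {M : Type*} [TopologicalSpace M]
    [ChartedSpace (EuclideanSpace ℝ (Fin n)) M]
    (F : Type*) [NormedAddCommGroup F] [NormedSpace ℝ F]
    {V : M → Type*} [TopologicalSpace (TotalSpace F V)] [∀ x, TopologicalSpace (V x)]
    [FiberBundle F V] (s : Π x, V x) : Prop :=
  ContMDiff (𝓡 n) ((𝓡 n).prod 𝓘(ℝ, F)) ∞ (fun x => TotalSpace.mk' F x (s x))

/-- `Γ_c(M, V)`: smooth compactly supported sections of `V`. -/
def testSections (n : ℕ) {M : Type*} [TopologicalSpace M]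
    [ChartedSpace (EuclideanSpace ℝ (Fin n)) M]
    (F : Type*) [NormedAddCommGroup F] [NormedSpace ℝ F]
    (V : M → Type*) [TopologicalSpace (TotalSpace F V)] [∀ x, TopologicalSpace (V x)]
    [∀ x, Zero (V x)] [FiberBundle F V] : Set (Π x, V x) :=
  {s | IsSmoothSection n F s ∧ IsCompact (closure {x | s x ≠ 0})}

/-- The gradient `df` of a complex-valued function, as a (complex) `1`-form. -/
def dC (n : ℕ) {M : Type*} [TopologicalSpace M]
    [ChartedSpace (EuclideanSpace ℝ (Fin n)) M] (f : M → ℂ) (x : M) : CotangentC n M x :=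
  mvfderiv (𝓡 n) f x

/-- Real part of a complex covector. -/
def covRe {n : ℕ} {M : Type*} [TopologicalSpace M]
    [ChartedSpace (EuclideanSpace ℝ (Fin n)) M] {x : M} (α : CotangentC n M x) : Cotangent n x :=
  Complex.reCLM.comp α

/-- Imaginary part of a complex covector. -/
def covIm {n : ℕ} {M : Type*} [TopologicalSpace M]
    [ChartedSpace (EuclideanSpace ℝ (Fin n)) M] {x : M} (α : CotangentC n M x) : Cotangent n x :=
  Complex.imCLM.comp α

/-! ### Riemannian metrics, the cometric, flatness -/

/-- Smooth Riemannian metrics on `M`. -/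
abbrev RiemMetric (n : ℕ) (M : Type*) [TopologicalSpace M]
    [ChartedSpace (EuclideanSpace ℝ (Fin n)) M] [IsManifold (𝓡 n) ∞ M] :=
  ContMDiffRiemannianMetric (𝓡 n) ∞ (EuclideanSpace ℝ (Fin n))
    (fun x : M => TangentSpace (𝓡 n) x)

/-- The isomorphism `T_x M ≃ T*_x M`, `u ↦ g(u, ·)` (lowering an index). -/
def lowerEquiv {n : ℕ} {M : Type*} [TopologicalSpace M]
    [ChartedSpace (EuclideanSpace ℝ (Fin n)) M] [IsManifold (𝓡 n) ∞ M]
    (g : RiemMetric n M) (x : M) : TangentSpace (𝓡 n) x ≃ₗ[ℝ] Cotangent n x :=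
  haveI : FiniteDimensional ℝ (TangentSpace (𝓡 n) x) :=
    inferInstanceAs (FiniteDimensional ℝ (EuclideanSpace ℝ (Fin n)))
  LinearEquiv.ofInjectiveOfFinrankEq (g.inner x : TangentSpace (𝓡 n) x →ₗ[ℝ] Cotangent n x)
    (by
      rw [← LinearMap.ker_eq_bot, LinearMap.ker_eq_bot']
      intro u hu
      by_contra h
      have h1 := g.pos x u h
      have h2 : g.inner x u = 0 := hu
      rw [h2] at h1
      simp at h1)
    (by
      have h := (LinearMap.toContinuousLinearMap (𝕜 := ℝ) (E := EuclideanSpace ℝ (Fin n))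
        (F' := ℝ)).finrank_eq
      refine Eq.trans ?_ h
      exact (Subspace.dual_finrank_eq (K := ℝ) (V := EuclideanSpace ℝ (Fin n))).symm)

theorem lowerEquiv_apply {n : ℕ} {M : Type*} [TopologicalSpace M]
    [ChartedSpace (EuclideanSpace ℝ (Fin n)) M] [IsManifold (𝓡 n) ∞ M]
    (g : RiemMetric n M) (x : M) (u v : TangentSpace (𝓡 n) x) :
    lowerEquiv g x u v = g.inner x u v := rfl

/-- The contravariant metric `g^{ab} α_a β_b` on real covectors. -/
def cometric {n : ℕ} {M : Type*} [TopologicalSpace M]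
    [ChartedSpace (EuclideanSpace ℝ (Fin n)) M] [IsManifold (𝓡 n) ∞ M]
    (g : RiemMetric n M) (x : M) (α β : Cotangent n x) : ℝ :=
  β ((lowerEquiv g x).symm α)

/-- `∇` is the Levi-Civita connection of `g`: smooth, torsion-free and metric.
Note that `∇_X Y` at `x` is written `cov Y x (X x)`. -/
def IsLeviCivita {n : ℕ} {M : Type*} [TopologicalSpace M]
    [ChartedSpace (EuclideanSpace ℝ (Fin n)) M] [IsManifold (𝓡 n) ∞ M] (g : RiemMetric n M)
    (cov : CovariantDerivative (𝓡 n) (EuclideanSpace ℝ (Fin n))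
      (fun x : M => TangentSpace (𝓡 n) x)) : Prop :=
  CovariantDerivative.ContMDiffCovariantDerivative cov ∞ ∧
  cov.torsion = 0 ∧
  ∀ X Y Z : Π x : M, TangentSpace (𝓡 n) x,
    IsSmoothSection n (EuclideanSpace ℝ (Fin n)) X →
    IsSmoothSection n (EuclideanSpace ℝ (Fin n)) Y →
    IsSmoothSection n (EuclideanSpace ℝ (Fin n)) Z →
    ∀ x : M, mvfderiv (𝓡 n) (fun y => g.inner y (Y y) (Z y)) x (X x) =
      g.inner x (cov Y x (X x)) (Z x) + g.inner x (Y x) (cov Z x (X x))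

/-- The curvature `R(X, Y)Z = ∇_X ∇_Y Z - ∇_Y ∇_X Z - ∇_{[X, Y]} Z`. -/
def curvature {n : ℕ} {M : Type*} [TopologicalSpace M]
    [ChartedSpace (EuclideanSpace ℝ (Fin n)) M] [IsManifold (𝓡 n) ∞ M]
    (cov : CovariantDerivative (𝓡 n) (EuclideanSpace ℝ (Fin n))
      (fun x : M => TangentSpace (𝓡 n) x))
    (X Y Z : Π x : M, TangentSpace (𝓡 n) x) (x : M) : TangentSpace (𝓡 n) x :=
  cov (fun y => cov Z y (Y y)) x (X x) - cov (fun y => cov Z y (X y)) x (Y x)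
    - cov Z x (VectorField.mlieBracket (𝓡 n) X Y x)

/-- `g` is flat: the curvature of its Levi-Civita connection vanishes. -/
def IsFlatMetric {n : ℕ} {M : Type*} [TopologicalSpace M]
    [ChartedSpace (EuclideanSpace ℝ (Fin n)) M] [IsManifold (𝓡 n) ∞ M]
    (g : RiemMetric n M) : Prop :=
  ∃ cov : CovariantDerivative (𝓡 n) (EuclideanSpace ℝ (Fin n))
      (fun x : M => TangentSpace (𝓡 n) x),
    IsLeviCivita g cov ∧
    ∀ X Y Z : Π x : M, TangentSpace (𝓡 n) x,
      IsSmoothSection n (EuclideanSpace ℝ (Fin n)) X →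
      IsSmoothSection n (EuclideanSpace ℝ (Fin n)) Y →
      IsSmoothSection n (EuclideanSpace ℝ (Fin n)) Z →
      ∀ x : M, curvature cov X Y Z x = 0

/-! ### Bivector fields and 2-forms -/

/-- A (real, smooth) bivector field `π`, as an alternating form on the cotangent spaces. -/
structure BivectorField (n : ℕ) (M : Type*) [TopologicalSpace M]
    [ChartedSpace (EuclideanSpace ℝ (Fin n)) M] [IsManifold (𝓡 n) ∞ M] where
  toFun : Π x : M, Cotangent n x →ₗ[ℝ] Cotangent n x →ₗ[ℝ] ℝ
  alt : ∀ x α, toFun x α α = 0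
  smooth : ∀ α β : Π x : M, TangentSpace (𝓡 n) x →L[ℝ] (Trivial M ℝ x),
    IsSmoothSection n (EuclideanSpace ℝ (Fin n) →L[ℝ] ℝ) α →
    IsSmoothSection n (EuclideanSpace ℝ (Fin n) →L[ℝ] ℝ) β →
    ContMDiff (𝓡 n) 𝓘(ℝ, ℝ) ∞ (fun x => toFun x (α x) (β x))

/-- The complex-bilinear extension `π(α, β) = π^{ij} α_i β_j` to complex covectors. -/
def BivectorField.complexify {n : ℕ} {M : Type*} [TopologicalSpace M]
    [ChartedSpace (EuclideanSpace ℝ (Fin n)) M] [IsManifold (𝓡 n) ∞ M]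
    (P : BivectorField n M) (x : M) (α β : CotangentC n M x) : ℂ :=
  ⟨P.toFun x (covRe α) (covRe β) - P.toFun x (covIm α) (covIm β),
    P.toFun x (covRe α) (covIm β) + P.toFun x (covIm α) (covRe β)⟩

/-- A (real, smooth) differential `2`-form. -/
structure TwoForm (n : ℕ) (M : Type*) [TopologicalSpace M]
    [ChartedSpace (EuclideanSpace ℝ (Fin n)) M] [IsManifold (𝓡 n) ∞ M] where
  toFun : Π x : M, TangentSpace (𝓡 n) x →L[ℝ] TangentSpace (𝓡 n) x →L[ℝ] ℝ
  alt : ∀ x u, toFun x u u = 0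
  smooth : ∀ X Y : Π x : M, TangentSpace (𝓡 n) x,
    IsSmoothSection n (EuclideanSpace ℝ (Fin n)) X →
    IsSmoothSection n (EuclideanSpace ℝ (Fin n)) Y →
    ContMDiff (𝓡 n) 𝓘(ℝ, ℝ) ∞ (fun x => toFun x (X x) (Y x))

/-- `ω` is inverse to `π`: `π^{ai} ω_{aj} = δ^i_j`, i.e. `π(ω(·, u), α) = α(u)`. -/
def TwoForm.IsInverseOf {n : ℕ} {M : Type*} [TopologicalSpace M]
    [ChartedSpace (EuclideanSpace ℝ (Fin n)) M] [IsManifold (𝓡 n) ∞ M]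
    (Ω : TwoForm n M) (P : BivectorField n M) : Prop :=
  ∀ (x : M) (u : TangentSpace (𝓡 n) x) (α β : Cotangent n x),
    (∀ v, β v = Ω.toFun x v u) → P.toFun x β α = α u

/-! ### Clifford bundles and Dirac-type operators -/

/-- A smooth representation on the complex bundle `V` of the bundle of Clifford algebras of
`(M, g)`, given on generators by Clifford multiplication `c : T*_x M → End_ℂ(V_x)` with
`c(α)c(β) + c(β)c(α) = 2 g^{ij} α_i β_j`. -/
structure CliffordBundle {n : ℕ} {M : Type*} [TopologicalSpace M]
    [ChartedSpace (EuclideanSpace ℝ (Fin n)) M] [IsManifold (𝓡 n) ∞ M] (g : RiemMetric n M)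
    (F : Type*) [NormedAddCommGroup F] [NormedSpace ℂ F]
    (V : M → Type*) [TopologicalSpace (TotalSpace F V)] [∀ x, TopologicalSpace (V x)]
    [∀ x, AddCommGroup (V x)] [∀ x, Module ℂ (V x)] [FiberBundle F V] where
  c : Π x : M, Cotangent n x →ₗ[ℝ] Module.End ℂ (V x)
  clifford : ∀ (x : M) (α β : Cotangent n x),
    c x α * c x β + c x β * c x α = ((2 * cometric g x α β : ℝ) : ℂ) • 1
  smooth : ∀ (α : Π x : M, TangentSpace (𝓡 n) x →L[ℝ] (Trivial M ℝ x)) (s : Π x, V x),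
    IsSmoothSection n (EuclideanSpace ℝ (Fin n) →L[ℝ] ℝ) α → IsSmoothSection n F s →
    IsSmoothSection n F (fun x => c x (α x) (s x))

/-- The complex-linear extension of Clifford multiplication to complex covectors. -/
def CliffordBundle.mulC {n : ℕ} {M : Type*} [TopologicalSpace M]
    [ChartedSpace (EuclideanSpace ℝ (Fin n)) M] [IsManifold (𝓡 n) ∞ M] {g : RiemMetric n M}
    {F : Type*} [NormedAddCommGroup F] [NormedSpace ℂ F]
    {V : M → Type*} [TopologicalSpace (TotalSpace F V)] [∀ x, TopologicalSpace (V x)]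
    [∀ x, AddCommGroup (V x)] [∀ x, Module ℂ (V x)] [FiberBundle F V]
    (S : CliffordBundle g F V) (x : M) (α : CotangentC n M x) (v : V x) : V x :=
  S.c x (covRe α) v + Complex.I • S.c x (covIm α) v

/-- `D₀` is a Dirac-type operator on `Γ_c(M, V)`: it is linear and `[D₀, f] = i c(df)`
(so a first-order differential operator whose principal symbol is Clifford multiplication).
Only the values of `D₀` on `Γ_c(M, V)` matter. -/
structure IsDiracType {n : ℕ} {M : Type*} [TopologicalSpace M]
    [ChartedSpace (EuclideanSpace ℝ (Fin n)) M] [IsManifold (𝓡 n) ∞ M] {g : RiemMetric n M}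
    {F : Type*} [NormedAddCommGroup F] [NormedSpace ℂ F]
    {V : M → Type*} [TopologicalSpace (TotalSpace F V)] [∀ x, TopologicalSpace (V x)]
    [∀ x, AddCommGroup (V x)] [∀ x, Module ℂ (V x)] [FiberBundle F V]
    (S : CliffordBundle g F V) (D₀ : (Π x, V x) → (Π x, V x)) : Prop where
  maps : ∀ s ∈ testSections n F V, D₀ s ∈ testSections n F V
  add : ∀ s ∈ testSections n F V, ∀ t ∈ testSections n F V, D₀ (s + t) = D₀ s + D₀ t
  smul : ∀ (z : ℂ), ∀ s ∈ testSections n F V, D₀ (z • s) = z • D₀ s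
  leibniz : ∀ f ∈ testFunctions n M, ∀ s ∈ testSections n F V, ∀ x : M,
    D₀ (fun y => f y • s y) x = f x • D₀ s x + Complex.I • S.mulC x (dC n f x) (s x)

/-! ### Deformations -/

section Algebra

variable {K : Type*} [CommRing K]

/-- `W / κ³ W`. -/
abbrev ModCube (κ : K) (W : Type*) [AddCommGroup W] [Module K W] : Type _ :=
  W ⧸ LinearMap.range (LinearMap.lsmul K W (κ ^ 3))

/-- The ring `ℂ[κ]/κ³`. -/
abbrev TruncPoly : Type := Polynomial ℂ ⧸ Ideal.span {(Polynomial.X ^ 3 : Polynomial ℂ)}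

/-- The action of `ℂ[κ]/κ³` on `W / κ³ W`, the indeterminate acting as `κ`. -/
def truncAction [Algebra ℂ K] (κ : K) (W : Type*) [AddCommGroup W] [Module K W] :
    TruncPoly →+* Module.End K (ModCube κ W) :=
  Ideal.Quotient.lift _
    ((algebraMap K (Module.End K (ModCube κ W))).comp
      (Polynomial.aeval κ : Polynomial ℂ →ₐ[ℂ] K).toRingHom)
    (by
      intro p hp
      obtain ⟨q, rfl⟩ := Ideal.mem_span_singleton'.mp hp
      refine LinearMap.ext fun w => ?_
      obtain ⟨w, rfl⟩ := Submodule.Quotient.mk_surjective _ w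
      have h : (Polynomial.aeval κ (q * Polynomial.X ^ 3)) • w
          ∈ LinearMap.range (LinearMap.lsmul K W (κ ^ 3)) :=
        ⟨Polynomial.aeval κ q • w, by simp [smul_smul, mul_comm]⟩
      exact (Submodule.Quotient.mk_eq_zero _).mpr h)

/-- `W / κ³ W` is a free `ℂ[κ]/κ³`-module. -/
def IsFreeModCube [Algebra ℂ K] (κ : K) (W : Type*) [AddCommGroup W] [Module K W] : Prop :=
  letI : Module TruncPoly (ModCube κ W) := Module.compHom _ (truncAction κ W)
  Module.Free TruncPoly (ModCube κ W)

/-- The structure of an `A`-bimodule (compatible with scalars in `K`) on the `K`-module `W`, for a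
not necessarily unital `K`-algebra `A`: `left a w = a w` and `right a w = w a`. -/
structure BimoduleStr (K A W : Type*) [CommRing K] [NonUnitalRing A] [Module K A]
    [AddCommGroup W] [Module K W] where
  left : A →ₗ[K] Module.End K W
  right : A →ₗ[K] Module.End K W
  left_mul : ∀ a b, left (a * b) = left a * left b
  right_mul : ∀ a b, right (a * b) = right b * right a
  assoc : ∀ a b, right b * left a = left a * right b

variable {A W : Type*} [NonUnitalRing A] [Module K A] [AddCommGroup W] [Module K W]

/-- `[D, a] = D a - a D`, as an operator on `W`. -/
def BimoduleStr.commD (B : BimoduleStr K A W) (D : Module.End K W) (a : A) : Module.End K W :=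
  D * B.left a - B.left a * D

/-- The space `Ω¹_D` of noncommutative `1`-forms: the `A`-bimodule of operators on `W` generated
by all the commutators `[D, a]`. -/
def BimoduleStr.forms (B : BimoduleStr K A W) (D : Module.End K W) :
    Submodule K (Module.End K W) :=
  sInf {P | (∀ a, B.commD D a ∈ P) ∧ ∀ a, ∀ T ∈ P, B.left a * T ∈ P ∧ T * B.left a ∈ P}

theorem BimoduleStr.commD_mem (B : BimoduleStr K A W) (D : Module.End K W) (a : A) :
    B.commD D a ∈ B.forms D := by
  simp only [BimoduleStr.forms, Submodule.mem_sInf]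
  exact fun P hP => hP.1 a

theorem BimoduleStr.left_mem (B : BimoduleStr K A W) (D : Module.End K W) (a : A)
    {T : Module.End K W} (hT : T ∈ B.forms D) : B.left a * T ∈ B.forms D := by
  simp only [BimoduleStr.forms, Submodule.mem_sInf] at hT ⊢
  exact fun P hP => (hP.2 a T (hT P hP)).1

theorem BimoduleStr.right_mem (B : BimoduleStr K A W) (D : Module.End K W) (a : A)
    {T : Module.End K W} (hT : T ∈ B.forms D) : T * B.left a ∈ B.forms D := by
  simp only [BimoduleStr.forms, Submodule.mem_sInf] at hT ⊢
  exact fun P hP => (hP.2 a T (hT P hP)).2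

/-- The bimodule structure of `Ω¹_D`: multiplication of operators by elements of `A`, acting on
`W` from the left. -/
def BimoduleStr.formsBimodule (B : BimoduleStr K A W) (D : Module.End K W) :
    BimoduleStr K A (B.forms D) where
  left :=
    { toFun := fun a =>
        { toFun := fun T => ⟨B.left a * T.1, B.left_mem D a T.2⟩
          map_add' := fun S T => Subtype.ext (mul_add _ _ _)
          map_smul' := fun k T => Subtype.ext (mul_smul_comm _ _ _) }
      map_add' := fun a b => LinearMap.ext fun T => Subtype.ext (by simp [add_mul])
      map_smul' := fun k a => LinearMap.ext fun T => Subtype.ext (by simp) }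
  right :=
    { toFun := fun a =>
        { toFun := fun T => ⟨T.1 * B.left a, B.right_mem D a T.2⟩
          map_add' := fun S T => Subtype.ext (add_mul _ _ _)
          map_smul' := fun k T => Subtype.ext (smul_mul_assoc _ _ _) }
      map_add' := fun a b => LinearMap.ext fun T => Subtype.ext (by simp [mul_add])
      map_smul' := fun k a => LinearMap.ext fun T => Subtype.ext (by simp) }
  left_mul := fun a b => LinearMap.ext fun T => Subtype.ext (by simp [B.left_mul, mul_assoc])
  right_mul := fun a b => LinearMap.ext fun T => Subtype.ext (by simp [B.left_mul, mul_assoc])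
  assoc := fun a b => LinearMap.ext fun T => Subtype.ext (by simp [mul_assoc])

/-- The differential `d a = -i [D, a]`, with values in `Ω¹_D`. -/
def BimoduleStr.d [Algebra ℂ K] (B : BimoduleStr K A W) (D : Module.End K W) (a : A) : B.forms D :=
  algebraMap ℂ K (-Complex.I) • ⟨B.commD D a, B.commD_mem D a⟩

end Algebra

/-- A smooth deformation (to second order) of `M`. The isomorphism of `ℂ`-algebras
`A / κA ≅ C_c^∞(M)` is given by the reduction map `red : A → C_c^∞(M)`, `a ↦ a mod κ`, a
surjective homomorphism with kernel `κA`. -/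
structure SmoothDeformation (n : ℕ) (M : Type*) [TopologicalSpace M]
    [ChartedSpace (EuclideanSpace ℝ (Fin n)) M] (K A : Type*) [CommRing K] [Algebra ℂ K]
    [NonUnitalRing A] [Module K A] [IsScalarTower K A A] [SMulCommClass K A A] where
  κ : K
  red : A →+ (M → ℂ)
  red_smul : ∀ (z : ℂ) (a : A), red (algebraMap ℂ K z • a) = z • red a
  red_mul : ∀ a b, red (a * b) = red a * red b
  range_red : Set.range red = testFunctions n M
  red_eq_zero_iff : ∀ a, red a = 0 ↔ ∃ b, a = κ • b
  free : IsFreeModCube κ A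

/-- `π` is the Poisson field of the deformation: the Poisson bracket, which is defined by
`κ {f, g} = i [a, b] mod κ²` for `f = a mod κ` and `g = b mod κ`, is `{f, g} = π(df, dg)`.
Here `c mod κ` is the bracket of `a mod κ` and `b mod κ` whenever `i [a, b] - κ c ∈ κ² A`. -/
def SmoothDeformation.IsPoissonField {n : ℕ} {M : Type*} [TopologicalSpace M]
    [ChartedSpace (EuclideanSpace ℝ (Fin n)) M] [IsManifold (𝓡 n) ∞ M]
    {K A : Type*} [CommRing K] [Algebra ℂ K]
    [NonUnitalRing A] [Module K A] [IsScalarTower K A A] [SMulCommClass K A A]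
    (𝒟 : SmoothDeformation n M K A) (P : BivectorField n M) : Prop :=
  ∀ a b c : A,
    (∃ e : A, algebraMap ℂ K Complex.I • (a * b - b * a) = 𝒟.κ • c + 𝒟.κ ^ 2 • e) →
    ∀ x : M, 𝒟.red c x = P.complexify x (dC n (𝒟.red a) x) (dC n (𝒟.red b) x)

/-- The `A`-bimodule `W` is a bimodule deformation of the complex vector bundle `V`. The
isomorphism `W / κW ≅ Γ_c(M, V)` of `C_c^∞(M)`-bimodules is given by the reduction map
`red : W → Γ_c(M, V)`, a surjective bimodule homomorphism with kernel `κW`. -/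
structure BimoduleDeformation {n : ℕ} {M : Type*} [TopologicalSpace M]
    [ChartedSpace (EuclideanSpace ℝ (Fin n)) M] {K A : Type*} [CommRing K] [Algebra ℂ K]
    [NonUnitalRing A] [Module K A] [IsScalarTower K A A] [SMulCommClass K A A]
    (𝒟 : SmoothDeformation n M K A)
    (F : Type*) [NormedAddCommGroup F] [NormedSpace ℝ F]
    (V : M → Type*) [TopologicalSpace (TotalSpace F V)] [∀ x, TopologicalSpace (V x)]
    [∀ x, AddCommGroup (V x)] [∀ x, Module ℂ (V x)] [FiberBundle F V]
    {W : Type*} [AddCommGroup W] [Module K W] (B : BimoduleStr K A W) where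
  red : W →+ (Π x, V x)
  red_smul : ∀ (z : ℂ) (w : W), red (algebraMap ℂ K z • w) = z • red w
  red_left : ∀ a w x, red (B.left a w) x = 𝒟.red a x • red w x
  red_right : ∀ a w x, red (B.right a w) x = 𝒟.red a x • red w x
  range_red : Set.range red = testSections n F V
  red_eq_zero_iff : ∀ w, red w = 0 ↔ ∃ w', w = 𝒟.κ • w'
  free : IsFreeModCube 𝒟.κ W

/-- A deformed spectral triple `(A, W, D)` for the Riemannian manifold `(M, g)`, where `W` deforms
the Spin bundle `V`. -/
structure DeformedSpectralTriple {n : ℕ} {M : Type*} [TopologicalSpace M]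
    [ChartedSpace (EuclideanSpace ℝ (Fin n)) M] [IsManifold (𝓡 n) ∞ M] (g : RiemMetric n M)
    (F : Type*) [NormedAddCommGroup F] [NormedSpace ℂ F]
    (V : M → Type*) [TopologicalSpace (TotalSpace F V)] [∀ x, TopologicalSpace (V x)]
    [∀ x, AddCommGroup (V x)] [∀ x, Module ℂ (V x)] [FiberBundle F V]
    (K A W : Type*) [CommRing K] [Algebra ℂ K]
    [NonUnitalRing A] [Module K A] [IsScalarTower K A A] [SMulCommClass K A A]
    [AddCommGroup W] [Module K W] where
  /-- the smooth deformation of `M` -/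
  deformation : SmoothDeformation n M K A
  /-- the Spin bundle structure of `V` -/
  spin : CliffordBundle g F V
  /-- the bimodule deformation of `V` -/
  bimodule : BimoduleStr K A W
  sections : BimoduleDeformation deformation F V bimodule
  /-- the `K`-linear operator `D` -/
  D : Module.End K W
  /-- the Dirac-type operator on sections of `V` -/
  dirac : (Π x, V x) → (Π x, V x)
  isDiracType : IsDiracType spin dirac
  /-- `D mod κ` is the Dirac-type operator -/
  red_D : ∀ w, sections.red (D w) = dirac (sections.red w)
  /-- `[D, a]` commutes with right multiplication by `A` -/
  commD_right : ∀ a b, bimodule.commD D a * bimodule.right b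
    = bimodule.right b * bimodule.commD D a
  /-- `Ω¹_D` is a bimodule deformation of the cotangent bundle -/
  oneForms : BimoduleDeformation deformation (EuclideanSpace ℝ (Fin n) →L[ℝ] ℂ) (CotangentC n M)
    (bimodule.formsBimodule D)
  /-- the derivation `d : A → Ω¹_D` reduces modulo `κ` to the gradient operator -/
  red_d : ∀ a x, oneForms.red (bimodule.d D a) x = dC n (deformation.red a) x

end

/-! The operator `ad a : w ↦ i (a w - w a)` on a bimodule deformation vanishes modulo `κ`, so
dividing it by `κ` gives an operation `(f, s) ↦ D_f s` on test functions and test sections: a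
contravariant connection, which differentiates sections along Hamiltonian directions. Freeness
modulo `κ³` is what makes division by `κ` and by `κ²` meaningful (`IsFreeModCube.exists_eq_smul`).
Every property of `D` is the leading term of an exact algebraic identity.

Flatness comes from `ad` being a Lie representation (`conn_conn_sub`), with Jacobi for the Poisson
bracket as the case of `A` acting on itself. On `1`-forms, torsion-freeness comes from `d` being a
derivation (`conn_dC_sub`).

Compatibility with the metric (`bracket_cometricC`) is where `D` commuting with right
multiplication, up to elements of `Ω¹_D`, enters. Let `S`, `R` in `Ω¹_D` lift `σ`, `τ` and let `q`
lift `g(σ, τ)`. Modulo `κ` forms act by Clifford multiplication, so `Y = S R + R S - 2 q` maps `W`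
into `κ W`. Since `Y` commutes with right multiplication, its commutator with left multiplication by
`a` can be computed with `ad a` instead, which gains a second factor `κ`. Hence `i [a, Y] / κ` is
zero modulo `κ`, and this is the product rule for `g(σ, τ)`.

The connection is a priori complex. Its imaginary part is a tensor, symmetric in two slots because
the torsion identity is real and skew in two slots because the metric is real; such a tensor
vanishes (`covIm_connR`).

Finally `ω` identifies covectors with vectors, `df` with the Hamiltonian field of `f`, and the
cometric with `g'`. The result is a derivative of vector fields along Hamiltonian fields, and these
fill every tangent space. Torsion-freeness forces the derivative to depend only on the value of the
Hamiltonian field at the point (`N_H_eq_zero`), so it extends to an ordinary connection. That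
connection is the Levi-Civita connection of `g'`, and its curvature vanishes because it vanishes on
Hamiltonian fields. -/

open scoped Topology

noncomputable section

/-! ### Smoothness criterion for sections of homomorphism bundles. -/

section

section HomCriterion

variable {n : ℕ} {M : Type*} [TopologicalSpace M]
  [ChartedSpace (EuclideanSpace ℝ (Fin n)) M]
  {F₁ F₂ : Type*} [NormedAddCommGroup F₁] [NormedSpace ℝ F₁] [FiniteDimensional ℝ F₁]
  [NormedAddCommGroup F₂] [NormedSpace ℝ F₂]
  {E₁ E₂ : M → Type*}
  [TopologicalSpace (TotalSpace F₁ E₁)] [∀ x, AddCommGroup (E₁ x)] [∀ x, Module ℝ (E₁ x)]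
  [∀ x, TopologicalSpace (E₁ x)] [FiberBundle F₁ E₁] [VectorBundle ℝ F₁ E₁]
  [TopologicalSpace (TotalSpace F₂ E₂)] [∀ x, AddCommGroup (E₂ x)] [∀ x, Module ℝ (E₂ x)]
  [∀ x, TopologicalSpace (E₂ x)] [∀ x, IsTopologicalAddGroup (E₂ x)]
  [∀ x, ContinuousSMul ℝ (E₂ x)] [FiberBundle F₂ E₂] [VectorBundle ℝ F₂ E₂]

/-- A section of a bundle of homomorphisms is smooth at a point as soon as every vector at that
point is the value of a smooth section whose image is smooth. -/
theorem contMDiffAt_hom_of_forall_exists (φ : Π x, E₁ x →L[ℝ] E₂ x) {x₀ : M}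
    (h : ∀ v : E₁ x₀, ∃ s : Π x, E₁ x, s x₀ = v ∧
      ContMDiffAt (𝓡 n) ((𝓡 n).prod 𝓘(ℝ, F₁)) ∞ (fun x => TotalSpace.mk' F₁ x (s x)) x₀ ∧
      ContMDiffAt (𝓡 n) ((𝓡 n).prod 𝓘(ℝ, F₂)) ∞ (fun x => TotalSpace.mk' F₂ x (φ x (s x))) x₀) :
    ContMDiffAt (𝓡 n) ((𝓡 n).prod 𝓘(ℝ, F₁ →L[ℝ] F₂)) ∞
      (fun x => TotalSpace.mk' (F₁ →L[ℝ] F₂) (E := fun x => E₁ x →L[ℝ] E₂ x) x (φ x)) x₀ := by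
  rw [contMDiffAt_hom_bundle]
  refine ⟨contMDiffAt_id, ?_⟩
  have hx₁ := FiberBundle.mem_baseSet_trivializationAt' (F := F₁) (E := E₁) x₀
  have hx₂ := FiberBundle.mem_baseSet_trivializationAt' (F := F₂) (E := E₂) x₀
  set e₁ := trivializationAt F₁ E₁ x₀
  set e₂ := trivializationAt F₂ E₂ x₀
  let b := Module.finBasis ℝ F₁
  choose s hs hsm htm using fun i => h (e₁.symmL ℝ x₀ (b i))
  simp_rw [contMDiffAt_section] at hsm htm
  let c : Fin (Module.finrank ℝ F₁) → F₁ →L[ℝ] ℝ := fun i =>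
    LinearMap.toContinuousLinearMap (b.coord i)
  -- In coordinates, `L x` sends the basis to the chosen sections and `R x` sends it to their
  -- images, so `φ ∘ L = R`. As `L x₀` is the identity, `L` is invertible nearby and `φ = R ∘ L⁻¹`
  -- is smooth.
  let L : M → F₁ →L[ℝ] F₁ := fun x => ∑ i, (c i).smulRight (e₁ ⟨x, s i x⟩).2
  let R : M → F₁ →L[ℝ] F₂ := fun x => ∑ i, (c i).smulRight (e₂ ⟨x, φ x (s i x)⟩).2
  have hL : ContMDiffAt (𝓡 n) 𝓘(ℝ, F₁ →L[ℝ] F₁) ∞ L x₀ := by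
    refine ContMDiffAt.sum fun i _ => ?_
    exact ((ContinuousLinearMap.smulRightL ℝ F₁ F₁ (c i)).contMDiff.contMDiffAt).comp x₀ (hsm i)
  have hR : ContMDiffAt (𝓡 n) 𝓘(ℝ, F₁ →L[ℝ] F₂) ∞ R x₀ := by
    refine ContMDiffAt.sum fun i _ => ?_
    exact ((ContinuousLinearMap.smulRightL ℝ F₁ F₂ (c i)).contMDiff.contMDiffAt).comp x₀ (htm i)
  have hL₀ : L x₀ = ContinuousLinearMap.id ℝ F₁ := by
    ext v
    have : ∀ i, (e₁ ⟨x₀, s i x₀⟩).2 = b i := fun i => by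
      rw [hs]
      have := e₁.continuousLinearMapAt_symmL (R := ℝ) hx₁ (b i)
      rwa [Trivialization.continuousLinearMapAt_apply, e₁.coe_linearMapAt_of_mem hx₁] at this
    simp only [L, this, sum_apply, ContinuousLinearMap.smulRight_apply,
      ContinuousLinearMap.id_apply]
    exact b.sum_repr v
  have hinv : ContMDiffAt (𝓡 n) 𝓘(ℝ, F₁ →L[ℝ] F₁) ∞ (fun x => (L x).inverse) x₀ := by
    have : ContDiffAt ℝ ∞ ContinuousLinearMap.inverse (L x₀) := by
      rw [hL₀]
      exact contDiffAt_map_inverse (ContinuousLinearEquiv.refl ℝ F₁)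
    exact this.contMDiffAt.comp x₀ hL
  have hunit : ∀ᶠ x in 𝓝 x₀, (L x).IsInvertible := by
    have hopen := ContinuousLinearEquiv.isOpen (𝕜 := ℝ) (E := F₁) (F := F₁)
    refine hL.continuousAt.eventually (hopen.mem_nhds ?_)
    rw [hL₀]
    exact ⟨ContinuousLinearEquiv.refl ℝ F₁, rfl⟩
  refine (hR.clm_comp hinv).congr_of_eventuallyEq ?_
  filter_upwards [hunit, e₁.open_baseSet.mem_nhds hx₁, e₂.open_baseSet.mem_nhds hx₂]
    with x hx hb₁ hb₂
  change _ = (R x).comp (L x).inverse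
  set Φ := ContinuousLinearMap.inCoordinates F₁ E₁ F₂ E₂ x₀ x x₀ x (φ x)
  have hΦ : Φ.comp (L x) = R x := by
    ext v
    simp only [L, R, ContinuousLinearMap.comp_apply, sum_apply,
      ContinuousLinearMap.smulRight_apply, map_sum, map_smul]
    refine Finset.sum_congr rfl fun i _ => ?_
    congr 1
    change ContinuousLinearMap.inCoordinates F₁ E₁ F₂ E₂ x₀ x x₀ x (φ x) _ = _
    simp [ContinuousLinearMap.inCoordinates_eq hb₁ hb₂, e₁, e₂, hb₁]
  obtain ⟨L', hL'⟩ := hx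
  rw [← hΦ, ← hL', ContinuousLinearMap.inverse_equiv]
  ext v
  simp

end HomCriterion

end

/-! ### Cut-offs, test sections and tensoriality. -/

section

section Cutoff

variable {n : ℕ} {M : Type*} [TopologicalSpace M]
  [ChartedSpace (EuclideanSpace ℝ (Fin n)) M]

/-- Smooth compactly supported real-valued functions. -/
def IsRealTest (n : ℕ) {M : Type*} [TopologicalSpace M]
    [ChartedSpace (EuclideanSpace ℝ (Fin n)) M] (f : M → ℝ) : Prop :=
  ContMDiff (𝓡 n) 𝓘(ℝ, ℝ) ∞ f ∧ HasCompactSupport f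

theorem IsRealTest.mul {f h : M → ℝ} (hf : IsRealTest n f) (hh : IsRealTest n h) :
    IsRealTest n (fun x => f x * h x) :=
  ⟨hf.1.mul hh.1, hf.2.mul_right⟩

theorem IsRealTest.add {f h : M → ℝ} (hf : IsRealTest n f) (hh : IsRealTest n h) :
    IsRealTest n (f + h) :=
  ⟨hf.1.add hh.1, hf.2.add hh.2⟩

theorem IsRealTest.const_smul {f : M → ℝ} (hf : IsRealTest n f) (c : ℝ) :
    IsRealTest n (c • f) :=
  ⟨contMDiff_const.mul hf.1, hf.2.mono (Function.support_const_smul_subset c f)⟩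

theorem exists_isRealTest_bump [T2Space M] [IsManifold (𝓡 n) ∞ M] {x₀ : M} {U : Set M}
    (hU : U ∈ 𝓝 x₀) :
    ∃ ψ : M → ℝ, IsRealTest n ψ ∧ (∀ᶠ x in 𝓝 x₀, ψ x = 1) ∧ tsupport ψ ⊆ U := by
  obtain ⟨f, -, hf⟩ := (SmoothBumpFunction.nhds_basis_tsupport (I := 𝓡 n) x₀).mem_iff.1 hU
  exact ⟨f, ⟨f.contMDiff, f.hasCompactSupport⟩, f.eventuallyEq_one, hf⟩

variable {F : Type*} [NormedAddCommGroup F] [NormedSpace ℝ F] {V : M → Type*}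
  [TopologicalSpace (TotalSpace F V)] [∀ x, AddCommGroup (V x)] [∀ x, Module ℝ (V x)]
  [∀ x, TopologicalSpace (V x)] [FiberBundle F V] [VectorBundle ℝ F V]

theorem add_mem_testSections {s t : Π x, V x} (hs : s ∈ testSections n F V)
    (ht : t ∈ testSections n F V) : s + t ∈ testSections n F V := by
  refine ⟨hs.1.add_section ht.1, (hs.2.union ht.2).of_isClosed_subset isClosed_closure ?_⟩
  rw [← closure_union]
  refine closure_mono fun x hx => ?_
  by_contra h
  simp only [Set.mem_union, Set.mem_ofPred_eq, not_or, not_not] at h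
  exact hx (by simp [h])

theorem smul_mem_testSections {f : M → ℝ} {s : Π x, V x}
    (hf : ContMDiff (𝓡 n) 𝓘(ℝ, ℝ) ∞ f) (hs : s ∈ testSections n F V) :
    (fun x => f x • s x) ∈ testSections n F V := by
  refine ⟨hf.smul_section hs.1, hs.2.of_isClosed_subset isClosed_closure
    (closure_mono fun x hx h => hx ?_)⟩
  simp [h]

theorem IsRealTest.smul_mem_testSections {f : M → ℝ} {s : Π x, V x}
    (hf : IsRealTest n f) (hs : IsSmoothSection n F s) :
    (fun x => f x • s x) ∈ testSections n F V := by
  refine ⟨hf.1.smul_section hs, hf.2.of_isClosed_subset isClosed_closure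
    (closure_mono fun x hx h => hx ?_)⟩
  simp [h]

theorem IsRealTest.smul_mem_testSections_of_contMDiffOn {f : M → ℝ} {s : Π x, V x} {U : Set M}
    (hf : IsRealTest n f) (hU : IsOpen U) (hfU : tsupport f ⊆ U)
    (hs : ContMDiffOn (𝓡 n) ((𝓡 n).prod 𝓘(ℝ, F)) ∞ (fun x => TotalSpace.mk' F x (s x)) U) :
    (fun x => f x • s x) ∈ testSections n F V := by
  refine ⟨ContMDiffOn.smul_section_of_tsupport hf.1.contMDiffOn hU hfU hs,
    hf.2.of_isClosed_subset isClosed_closure (closure_mono fun x hx h => hx ?_)⟩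
  simp [h]

theorem zero_mem_testSections : (0 : Π x, V x) ∈ testSections n F V :=
  ⟨contMDiff_zeroSection ℝ V, by simp⟩

theorem sum_mem_testSections {ι : Type*} (S : Finset ι) (s : ι → Π x, V x)
    (hs : ∀ i ∈ S, s i ∈ testSections n F V) : ∑ i ∈ S, s i ∈ testSections n F V :=
  Finset.sum_induction s (· ∈ testSections n F V) (fun _ _ => add_mem_testSections)
    zero_mem_testSections hs

section Frame

variable {ι : Type*} (b : Module.Basis ι ℝ F)
  (e : Trivialization F (TotalSpace.proj : TotalSpace F V → M)) [MemTrivializationAtlas e]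
  {ψ : M → ℝ}

section

variable [ContMDiffVectorBundle 1 F V (𝓡 n)]

/-- The cut-off is spent twice, once on the coefficient and once on the frame field, so that both
factors of each term are globally defined test objects. -/
theorem sum_cutoff_localFrame [Fintype ι] (hψe : tsupport ψ ⊆ e.baseSet) (s : Π x, V x) :
    (∑ i, fun x => (ψ x * e.localFrameCoeff (𝓡 n) b i x (s x)) • (ψ x • e.localFrame b i x)) =
      fun x => (ψ x * ψ x) • s x := by
  funext x
  rw [Finset.sum_apply]
  by_cases hx : x ∈ tsupport ψ
  · conv_rhs => rw [e.eq_sum_localFrameCoeff_smul (I := 𝓡 n) (b := b) (s := s) (hψe hx)]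
    rw [Finset.smul_sum]
    exact Finset.sum_congr rfl fun i _ => by module
  · simp [image_eq_zero_of_notMem_tsupport hx]

end

variable [ContMDiffVectorBundle ∞ F V (𝓡 n)]

theorem cutoff_localFrame_mem_testSections (hψ : IsRealTest n ψ) (hψe : tsupport ψ ⊆ e.baseSet)
    (i : ι) :
    (fun x => ψ x • e.localFrame b i x) ∈ testSections n F V :=
  hψ.smul_mem_testSections_of_contMDiffOn e.open_baseSet hψe
    (e.contMDiffOn_localFrame_baseSet ∞ b i)

variable [ContMDiffVectorBundle 1 F V (𝓡 n)]

theorem cutoff_localFrameCoeff_isRealTest [FiniteDimensional ℝ F] (hψ : IsRealTest n ψ)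
    (hψe : tsupport ψ ⊆ e.baseSet) {s : Π x, V x} (hs : IsSmoothSection n F s) (i : ι) :
    IsRealTest n (fun x => ψ x * e.localFrameCoeff (𝓡 n) b i x (s x)) := by
  refine ⟨fun x => ?_, hψ.2.mul_right⟩
  by_cases hx : x ∈ tsupport ψ
  · exact hψ.1.contMDiffAt.mul
      (contMDiffAt_localFrameCoeff (k := ∞) b (hψe hx) (hs x) i)
  · have h0 : (fun x => ψ x * e.localFrameCoeff (𝓡 n) b i x (s x)) =ᶠ[𝓝 x] fun _ => 0 := by
      filter_upwards [(isClosed_tsupport ψ).isOpen_compl.mem_nhds hx] with y hy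
      simp [image_eq_zero_of_notMem_tsupport hy]
    exact contMDiffAt_const.congr_of_eventuallyEq h0

end Frame

variable [ContMDiffVectorBundle ∞ F V (𝓡 n)]

/-- An additive operation on test sections which is linear over test functions at a point depends
only on the value of the section there. -/
theorem eq_zero_of_tensorial [T2Space M] [IsManifold (𝓡 n) ∞ M] [FiniteDimensional ℝ F]
    {B : Type*} [AddCommGroup B] [Module ℝ B] (J : (Π x, V x) → B) (x₀ : M)
    (hadd : ∀ s ∈ testSections n F V, ∀ t ∈ testSections n F V, J (s + t) = J s + J t)
    (hsmul : ∀ f, IsRealTest n f → ∀ s ∈ testSections n F V,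
      J (fun x => f x • s x) = f x₀ • J s)
    {s : Π x, V x} (hs : s ∈ testSections n F V) (hs₀ : s x₀ = 0) : J s = 0 := by
  have : ContMDiffVectorBundle 1 F V (𝓡 n) := ContMDiffVectorBundle.of_le (n := ∞) (by simp)
  let e := trivializationAt F V x₀
  have hx₀ : x₀ ∈ e.baseSet := FiberBundle.mem_baseSet_trivializationAt' x₀
  obtain ⟨ψ, hψ, hψ1, hψe⟩ := exists_isRealTest_bump (n := n) (e.open_baseSet.mem_nhds hx₀)
  let b := Module.finBasis ℝ F
  -- `ψ²` equals one at `x₀`, so `s` may be replaced by `ψ² s`; the latter is a sum of test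
  -- functions vanishing at `x₀` times test sections.
  have h1 : J (fun x => (ψ x * ψ x) • s x) = J s := by
    rw [hsmul _ (hψ.mul hψ) s hs, hψ1.self_of_nhds]
    simp
  have hJ0 : J 0 = 0 := by
    have := hadd 0 zero_mem_testSections 0 zero_mem_testSections
    simpa using this
  have hterm : ∀ i, (fun x => (ψ x * e.localFrameCoeff (𝓡 n) b i x (s x)) •
      (ψ x • e.localFrame b i x)) ∈ testSections n F V := fun i =>
    _root_.smul_mem_testSections (cutoff_localFrameCoeff_isRealTest b e hψ hψe hs.1 i).1
      (cutoff_localFrame_mem_testSections b e hψ hψe i)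
  have hsum : ∀ S : Finset (Fin (Module.finrank ℝ F)),
      J (∑ i ∈ S, fun x => (ψ x * e.localFrameCoeff (𝓡 n) b i x (s x)) •
        (ψ x • e.localFrame b i x)) = 0 := by
    intro S
    classical
    induction S using Finset.induction_on with
    | empty => simpa using hJ0
    | insert i S hi ih =>
      rw [Finset.sum_insert hi, hadd _ (hterm i) _ (sum_mem_testSections _ _ fun j _ => hterm j),
        ih, hsmul _ (cutoff_localFrameCoeff_isRealTest b e hψ hψe hs.1 i) _
          (cutoff_localFrame_mem_testSections b e hψ hψe i), hs₀]
      simp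
  rw [← h1, ← sum_cutoff_localFrame (n := n) b e hψe s, hsum]

end Cutoff

end

/-! ### Differentials of test functions and the Lie bracket of vector fields. -/

section

section Differentials

variable {n : ℕ} {M : Type*} [TopologicalSpace M]
  [ChartedSpace (EuclideanSpace ℝ (Fin n)) M]

theorem mvfderiv_congr {F : Type*} [NormedAddCommGroup F] [NormedSpace ℝ F] {f h : M → F} {x : M}
    (hfh : f =ᶠ[𝓝 x] h) : mvfderiv (𝓡 n) f x = mvfderiv (𝓡 n) h x := by
  ext v
  change mfderiv (𝓡 n) 𝓘(ℝ, F) f x v = mfderiv (𝓡 n) 𝓘(ℝ, F) h x v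
  rw [hfh.mfderiv_eq]
  rfl

variable [IsManifold (𝓡 n) ∞ M]

/-- Every covector is the differential of a test function. -/
theorem exists_isRealTest_mvfderiv_eq [T2Space M] (x : M) (α : Cotangent n x) :
    ∃ f : M → ℝ, IsRealTest n f ∧ mvfderiv (𝓡 n) f x = α := by
  let φ := extChartAt (𝓡 n) x
  let a : EuclideanSpace ℝ (Fin n) →L[ℝ] ℝ := α
  -- The function is the covector read as a linear function of the preferred chart at `x`, cut off;
  -- the derivative of that chart at its own centre is the identity.
  obtain ⟨ψ, hψ, hψ1, hψU⟩ := exists_isRealTest_bump (n := n)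
    ((chartAt (EuclideanSpace ℝ (Fin n)) x).open_source.mem_nhds (mem_chart_source _ x))
  have hφ : ContMDiffOn (𝓡 n) 𝓘(ℝ, ℝ) ∞ (fun y => a (φ y))
      (chartAt (EuclideanSpace ℝ (Fin n)) x).source :=
    a.contMDiff.comp_contMDiffOn contMDiffOn_extChartAt
  refine ⟨fun y => ψ y * a (φ y), ⟨fun y => ?_, hψ.2.mul_right⟩, ?_⟩
  · by_cases hy : y ∈ tsupport ψ
    · exact hψ.1.contMDiffAt.mul (hφ.contMDiffAt
        ((chartAt (EuclideanSpace ℝ (Fin n)) x).open_source.mem_nhds (hψU hy)))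
    · have h0 : (fun y => ψ y * a (φ y)) =ᶠ[𝓝 y] fun _ => 0 := by
        filter_upwards [(isClosed_tsupport ψ).isOpen_compl.mem_nhds hy] with z hz
        simp [image_eq_zero_of_notMem_tsupport hz]
      exact contMDiffAt_const.congr_of_eventuallyEq h0
  · have h1 : (fun y => ψ y * a (φ y)) =ᶠ[𝓝 x] fun y => a (φ y) := by
      filter_upwards [hψ1] with y hy
      simp [hy]
    rw [mvfderiv_congr h1]
    have h2 : HasMFDerivAt (𝓡 n) 𝓘(ℝ, ℝ) (fun y => a (φ y)) x
        (a ∘L mfderiv (𝓡 n) 𝓘(ℝ, EuclideanSpace ℝ (Fin n)) φ x) :=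
      a.hasMFDerivAt.comp x (mdifferentiableAt_extChartAt (mem_chart_source _ x)).hasMFDerivAt
    ext v
    change mfderiv (𝓡 n) 𝓘(ℝ, ℝ) (fun y => a (φ y)) x v = α v
    rw [h2.mfderiv, mfderiv_extChartAt_self]
    rfl

/-- Tangent vectors are separated by the differentials of test functions. -/
theorem eq_of_forall_mvfderiv_eq [T2Space M] {x : M} {u v : TangentSpace (𝓡 n) x}
    (h : ∀ f : M → ℝ, IsRealTest n f → mvfderiv (𝓡 n) f x u = mvfderiv (𝓡 n) f x v) : u = v := by
  have key : ∀ a : EuclideanSpace ℝ (Fin n) →L[ℝ] ℝ, a u = a v := fun a => by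
    obtain ⟨f, hf, hfa⟩ := exists_isRealTest_mvfderiv_eq x (a : Cotangent n x)
    have := h f hf
    rw [hfa] at this
    exact this
  exact (SeparatingDual.eq_iff_forall_dual_eq (R := ℝ)
    (V := EuclideanSpace ℝ (Fin n))).2 fun a => key a

/-- A vector field read in a chart differentiates functions read in that chart. -/
theorem fderiv_comp_extChartAt_symm_mpullbackWithin {X : Π x : M, TangentSpace (𝓡 n) x}
    {h : M → ℝ} {x : M} {z : EuclideanSpace ℝ (Fin n)} (hz : z ∈ (extChartAt (𝓡 n) x).target)
    (hh : MDifferentiableAt (𝓡 n) 𝓘(ℝ, ℝ) h ((extChartAt (𝓡 n) x).symm z)) :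
    fderiv ℝ (h ∘ (extChartAt (𝓡 n) x).symm) z
        (VectorField.mpullbackWithin 𝓘(ℝ, EuclideanSpace ℝ (Fin n)) (𝓡 n)
          (extChartAt (𝓡 n) x).symm X (Set.range (𝓡 n)) z) =
      mvfderiv (𝓡 n) h ((extChartAt (𝓡 n) x).symm z) (X ((extChartAt (𝓡 n) x).symm z)) := by
  have hφ := mdifferentiableWithinAt_extChartAt_symm hz
  have hinv := isInvertible_mfderivWithin_extChartAt_symm hz
  have hr : Set.range (𝓡 n) = Set.univ := (𝓡 n).range_eq_univ
  rw [VectorField.mpullbackWithin_apply]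
  rw [hr] at hφ hinv ⊢
  rw [mfderivWithin_univ] at hinv ⊢
  rw [mdifferentiableWithinAt_univ] at hφ
  rw [← mfderiv_eq_fderiv, mfderiv_comp z hh hφ]
  change mfderiv (𝓡 n) 𝓘(ℝ, ℝ) h _ (mfderiv _ _ _ z _) = _
  rw [hinv.self_apply_inverse]
  rfl

/-- The Lie bracket acts on functions as the commutator of derivations. -/
theorem mvfderiv_mlieBracket {X Y : Π x : M, TangentSpace (𝓡 n) x} {f : M → ℝ}
    (hX : IsSmoothSection n (EuclideanSpace ℝ (Fin n)) X)
    (hY : IsSmoothSection n (EuclideanSpace ℝ (Fin n)) Y)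
    (hf : ContMDiff (𝓡 n) 𝓘(ℝ, ℝ) ∞ f)
    (hXf : ContMDiff (𝓡 n) 𝓘(ℝ, ℝ) ∞ fun y => mvfderiv (𝓡 n) f y (X y))
    (hYf : ContMDiff (𝓡 n) 𝓘(ℝ, ℝ) ∞ fun y => mvfderiv (𝓡 n) f y (Y y)) (x : M) :
    mvfderiv (𝓡 n) f x (VectorField.mlieBracket (𝓡 n) X Y x) =
      mvfderiv (𝓡 n) (fun y => mvfderiv (𝓡 n) f y (Y y)) x (X x) -
        mvfderiv (𝓡 n) (fun y => mvfderiv (𝓡 n) f y (X y)) x (Y x) := by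
  let φ := extChartAt (𝓡 n) x
  have hr : Set.range (𝓡 n) = Set.univ := (𝓡 n).range_eq_univ
  let pb : (Π x : M, TangentSpace (𝓡 n) x) → EuclideanSpace ℝ (Fin n) →
    EuclideanSpace ℝ (Fin n) := fun X =>
      VectorField.mpullbackWithin 𝓘(ℝ, EuclideanSpace ℝ (Fin n)) (𝓡 n) φ.symm X (Set.range (𝓡 n))
  have hx : φ.symm (φ x) = x := extChartAt_to_inv x
  have hmem : φ x ∈ φ.target := mem_extChartAt_target x
  have hopen : φ.target ∈ 𝓝 (φ x) := extChartAt_target_mem_nhds x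
  have hdiff : ∀ {h : M → ℝ}, ContMDiff (𝓡 n) 𝓘(ℝ, ℝ) ∞ h → ∀ z,
      MDifferentiableAt (𝓡 n) 𝓘(ℝ, ℝ) h z := fun hh z =>
    hh.mdifferentiable (by simp) z
  have hpb : ∀ {X : Π x : M, TangentSpace (𝓡 n) x},
      IsSmoothSection n (EuclideanSpace ℝ (Fin n)) X → DifferentiableAt ℝ (pb X) (φ x) := by
    intro X hX
    have h1 : MDifferentiableWithinAt (𝓡 n) ((𝓡 n).prod 𝓘(ℝ, EuclideanSpace ℝ (Fin n)))
        (fun x => (X x : TangentBundle (𝓡 n) M)) Set.univ x :=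
      (hX.mdifferentiable (by simp) x).mdifferentiableWithinAt
    have h2 : DifferentiableWithinAt ℝ (pb X) (φ.symm ⁻¹' Set.univ ∩ Set.range (𝓡 n)) (φ x) :=
      h1.differentiableWithinAt_mpullbackWithin_vectorField
    rwa [Set.preimage_univ, Set.univ_inter, hr, differentiableWithinAt_univ] at h2
  have hG : ContDiffAt ℝ ∞ (f ∘ φ.symm) (φ x) := by
    have := (hf.contMDiffOn (s := Set.univ)).comp (contMDiffOn_extChartAt_symm (n := ∞) x)
      (fun _ _ => Set.mem_univ _)
    exact (this.contMDiffAt hopen).contDiffAt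
  have hact : ∀ (X : Π x : M, TangentSpace (𝓡 n) x) {h : M → ℝ},
      ContMDiff (𝓡 n) 𝓘(ℝ, ℝ) ∞ h → fderiv ℝ (h ∘ φ.symm) (φ x) (pb X (φ x)) =
        mvfderiv (𝓡 n) h x (X x) := by
    intro X h hh
    have := fderiv_comp_extChartAt_symm_mpullbackWithin (X := X) hmem (hdiff hh _)
    change fderiv ℝ (h ∘ φ.symm) (φ x) (pb X (φ x)) = _ at this
    rw [this, hx]
  have hev : ∀ (X : Π x : M, TangentSpace (𝓡 n) x),
      (fun z => fderiv ℝ (f ∘ φ.symm) z (pb X z)) =ᶠ[𝓝 (φ x)]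
        (fun y => mvfderiv (𝓡 n) f y (X y)) ∘ φ.symm := by
    intro X
    filter_upwards [hopen] with z hz
    exact fderiv_comp_extChartAt_symm_mpullbackWithin hz (hdiff hf _)
  have hbr : VectorField.mlieBracket (𝓡 n) X Y x =
      VectorField.lieBracket ℝ (pb X) (pb Y) (φ x) := by
    -- The bracket on the manifold pulls back the bracket in the chart by the derivative of the
    -- chart, which at the centre is the identity.
    have hid : (mfderiv (𝓡 n) 𝓘(ℝ, EuclideanSpace ℝ (Fin n)) φ x :
        EuclideanSpace ℝ (Fin n) →L[ℝ] EuclideanSpace ℝ (Fin n)) =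
          ContinuousLinearMap.id ℝ (EuclideanSpace ℝ (Fin n)) := mfderiv_extChartAt_self
    have hinv : ∀ (L : EuclideanSpace ℝ (Fin n) →L[ℝ] EuclideanSpace ℝ (Fin n)),
        L = ContinuousLinearMap.id ℝ (EuclideanSpace ℝ (Fin n)) → ∀ v, L.inverse v = v := by
      rintro _ rfl v
      simp
    refine (hinv _ hid _).trans ?_
    change VectorField.lieBracketWithin ℝ (pb X) (pb Y)
      (φ.symm ⁻¹' Set.univ ∩ Set.range (𝓡 n)) (φ x) = _
    rw [Set.preimage_univ, Set.univ_inter, hr, VectorField.lieBracketWithin_univ]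
  have hd : mvfderiv (𝓡 n) f x = fderiv ℝ (f ∘ φ.symm) (φ x) := by
    rw [(hdiff hf x).mvfderiv, hr, fderivWithin_univ]
    rfl
  rw [hbr, hd]
  -- In the chart this is the symmetry of the second derivative of `f`.
  refine (VectorField.fderiv_apply_lieBracket hG (by simpa using ENat.LEInfty.out) (hpb hY)
    (hpb hX)).trans ?_
  rw [(hev Y).fderiv_eq, (hev X).fderiv_eq, hact X hYf, hact Y hXf]

end Differentials

end

/-! ### Algebra of the deformation parameter: cancelling `κ`, and the commutator action. -/

section

section Truncated

/-- In a free module over `ℂ[κ]/κ³`, every element killed by `κ²` is divisible by `κ`. -/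
theorem exists_eq_smul_of_sq_smul_eq_zero {Q : Type*} [AddCommGroup Q] [Module TruncPoly Q]
    [Module.Free TruncPoly Q] {m : Q}
    (h : (Ideal.Quotient.mk _ Polynomial.X : TruncPoly) ^ 2 • m = 0) :
    ∃ q : Q, m = (Ideal.Quotient.mk _ Polynomial.X : TruncPoly) • q := by
  let b := Module.Free.chooseBasis TruncPoly Q
  let X : TruncPoly := Ideal.Quotient.mk _ Polynomial.X
  have hc : ∀ i, ∃ c, b.repr m i = X * c := by
    intro i
    obtain ⟨p, hp⟩ := Ideal.Quotient.mk_surjective (b.repr m i)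
    have h0 : X ^ 2 * b.repr m i = 0 := by
      have := congrArg (fun q => b.repr q i) h
      simpa using this
    rw [← hp, ← map_pow, ← map_mul, Ideal.Quotient.eq_zero_iff_mem,
      Ideal.mem_span_singleton, pow_succ] at h0
    -- Coordinatewise, `X³ ∣ X² p` in the domain `ℂ[X]`, hence `X ∣ p`.
    obtain ⟨q, rfl⟩ := (mul_dvd_mul_iff_left (pow_ne_zero 2 Polynomial.X_ne_zero)).1 h0
    exact ⟨Ideal.Quotient.mk _ q, by rw [← hp, map_mul]⟩
  have hmem : m ∈ LinearMap.range (LinearMap.lsmul TruncPoly Q X) := by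
    rw [← b.linearCombination_repr m, Finsupp.linearCombination_apply, Finsupp.sum]
    refine Submodule.sum_mem _ fun i _ => ?_
    obtain ⟨c, hc⟩ := hc i
    exact ⟨c • b i, by rw [hc, mul_smul, LinearMap.lsmul_apply]⟩
  obtain ⟨q, hq⟩ := hmem
  exact ⟨q, hq.symm⟩

variable {K : Type*} [CommRing K] [Algebra ℂ K]

/-- The sole use of freeness: it allows `κ` and `κ²` to be cancelled from an identity at the cost of
knowing the result only modulo `κ`. -/
theorem IsFreeModCube.exists_eq_smul {κ : K} {W : Type*} [AddCommGroup W] [Module K W]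
    (hW : IsFreeModCube κ W) {w e : W} (h : κ ^ 2 • w = κ ^ 3 • e) : ∃ v, w = κ • v := by
  let _ : Module TruncPoly (ModCube κ W) := Module.compHom _ (truncAction κ W)
  have : Module.Free TruncPoly (ModCube κ W) := hW
  have hX : ∀ v : W, (Ideal.Quotient.mk _ Polynomial.X : TruncPoly) •
      (Submodule.Quotient.mk v : ModCube κ W) = Submodule.Quotient.mk (κ • v) := by
    intro v
    change truncAction κ W (Ideal.Quotient.mk _ Polynomial.X) (Submodule.Quotient.mk v) = _
    simp [truncAction]
  obtain ⟨q, hq⟩ := exists_eq_smul_of_sq_smul_eq_zero (m := (Submodule.Quotient.mk w : ModCube κ W))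
    (by
      rw [pow_two, mul_smul, hX, hX, Submodule.Quotient.mk_eq_zero]
      exact ⟨e, by rw [LinearMap.lsmul_apply, ← h, pow_two, mul_smul]⟩)
  obtain ⟨v, rfl⟩ := Submodule.Quotient.mk_surjective _ q
  rw [hX, Submodule.Quotient.eq] at hq
  obtain ⟨u, hu⟩ := hq
  -- The quotient only gives `w - κ v = κ³ u`; the error term is absorbed into the witness.
  refine ⟨v + κ ^ 2 • u, ?_⟩
  rw [LinearMap.lsmul_apply] at hu
  rw [smul_add, smul_smul, ← pow_succ', hu]
  abel

end Truncated

section Adjoint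

variable {K A W : Type*} [CommRing K] [Algebra ℂ K] [NonUnitalRing A] [Module K A]
  [AddCommGroup W] [Module K W]

/-- The operator `w ↦ i (a w - w a)`. -/
def BimoduleStr.ad (B : BimoduleStr K A W) (a : A) : Module.End K W :=
  algebraMap ℂ K Complex.I • (B.left a - B.right a)

theorem BimoduleStr.ad_add (B : BimoduleStr K A W) (a b : A) : B.ad (a + b) = B.ad a + B.ad b := by
  simp only [ad, map_add]
  module

theorem BimoduleStr.ad_smul (B : BimoduleStr K A W) (k : K) (a : A) :
    B.ad (k • a) = k • B.ad a := by
  simp only [ad, map_smul]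
  module

/-- `ad` is a Lie representation for the bracket `i [a, b]`, because left and right multiplication
commute. Flatness and the Jacobi identity are its leading terms. -/
theorem BimoduleStr.ad_comm (B : BimoduleStr K A W) (a b : A) :
    B.ad a * B.ad b - B.ad b * B.ad a =
      B.ad (algebraMap ℂ K Complex.I • (a * b - b * a)) := by
  rw [ad_smul]
  simp only [ad, smul_mul_assoc, mul_smul_comm, smul_smul, ← smul_sub, map_sub, B.left_mul,
    B.right_mul]
  congr 1
  have h1 := B.assoc a b
  have h2 := B.assoc b a
  simp only [mul_sub, sub_mul, h1, h2]
  abel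

/-- The product rule for commutators, the source of the Leibniz rule of the contravariant
connection. -/
theorem BimoduleStr.ad_left (B : BimoduleStr K A W) (a b : A) :
    B.ad a * B.left b =
      B.left (algebraMap ℂ K Complex.I • (a * b - b * a)) + B.left b * B.ad a := by
  simp only [ad, smul_mul_assoc, mul_smul_comm, map_smul, map_sub, B.left_mul, mul_sub, sub_mul,
    B.assoc]
  module

/-- A non-unital algebra as a bimodule over itself. -/
def BimoduleStr.self (K A : Type*) [CommRing K] [NonUnitalRing A] [Module K A]
    [IsScalarTower K A A] [SMulCommClass K A A] : BimoduleStr K A A where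
  left := LinearMap.mul K A
  right := (LinearMap.mul K A).flip
  left_mul a b := LinearMap.ext fun c => mul_assoc a b c
  right_mul a b := LinearMap.ext fun c => (mul_assoc c a b).symm
  assoc a b := LinearMap.ext fun c => mul_assoc a c b

theorem BimoduleStr.ad_self_apply [IsScalarTower K A A] [SMulCommClass K A A] (a b : A) :
    (BimoduleStr.self K A).ad a b = algebraMap ℂ K Complex.I • (a * b - b * a) := rfl

theorem BimoduleStr.d_smul (B : BimoduleStr K A W) (D : Module.End K W) (k : K) (a : A) :
    B.d D (k • a) = k • B.d D a := by
  refine Subtype.ext ?_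
  simp only [d, commD, map_smul, mul_smul_comm, smul_mul_assoc, Submodule.coe_smul]
  module

/-- The derivation property of `d` applied to `i (a b - b a)`; dividing by `κ` gives vanishing
torsion. -/
theorem BimoduleStr.ad_d (B : BimoduleStr K A W) (D : Module.End K W) (a b : A) :
    (B.formsBimodule D).ad a (B.d D b) - (B.formsBimodule D).ad b (B.d D a) =
      B.d D (algebraMap ℂ K Complex.I • (a * b - b * a)) := by
  rw [d_smul]
  refine Subtype.ext ?_
  simp only [ad, d, formsBimodule, commD, LinearMap.smul_apply, LinearMap.sub_apply,
    LinearMap.coe_mk, AddHom.coe_mk, map_sub, B.left_mul, Submodule.coe_smul, Submodule.coe_sub,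
    mul_sub, sub_mul, mul_smul_comm, smul_mul_assoc, mul_assoc]
  module

end Adjoint

end

/-! ### The contravariant connection of a bimodule deformation. -/

section

section Connection

variable {n : ℕ} {M : Type*} [TopologicalSpace M]
  [ChartedSpace (EuclideanSpace ℝ (Fin n)) M] {K A : Type*} [CommRing K] [Algebra ℂ K]
  [NonUnitalRing A] [Module K A] [IsScalarTower K A A] [SMulCommClass K A A]
  {𝒟 : SmoothDeformation n M K A}

namespace SmoothDeformation

theorem red_κ_smul (𝒟 : SmoothDeformation n M K A) (a : A) : 𝒟.red (𝒟.κ • a) = 0 :=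
  (𝒟.red_eq_zero_iff _).2 ⟨a, rfl⟩

theorem red_ad (𝒟 : SmoothDeformation n M K A) (a b : A) :
    𝒟.red ((BimoduleStr.self K A).ad a b) = 0 := by
  rw [BimoduleStr.ad_self_apply, 𝒟.red_smul, map_sub, 𝒟.red_mul, 𝒟.red_mul, mul_comm, sub_self,
    smul_zero]

theorem exists_ad_eq (𝒟 : SmoothDeformation n M K A) (a b : A) :
    ∃ c, (BimoduleStr.self K A).ad a b = 𝒟.κ • c :=
  (𝒟.red_eq_zero_iff _).1 (𝒟.red_ad a b)

theorem exists_lift (𝒟 : SmoothDeformation n M K A) {f : M → ℂ} (hf : f ∈ testFunctions n M) :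
    ∃ a, 𝒟.red a = f := by
  rw [← 𝒟.range_red] at hf
  exact hf

theorem red_mem (𝒟 : SmoothDeformation n M K A) (a : A) : 𝒟.red a ∈ testFunctions n M := by
  rw [← 𝒟.range_red]
  exact ⟨a, rfl⟩

end SmoothDeformation

namespace BimoduleDeformation

variable {F : Type*} [NormedAddCommGroup F] [NormedSpace ℝ F] {V : M → Type*}
  [TopologicalSpace (TotalSpace F V)] [∀ x, TopologicalSpace (V x)]
  [∀ x, AddCommGroup (V x)] [∀ x, Module ℂ (V x)] [FiberBundle F V]
  {W : Type*} [AddCommGroup W] [Module K W] {B : BimoduleStr K A W}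
  (E : BimoduleDeformation 𝒟 F V B)

theorem red_κ_smul (w : W) : E.red (𝒟.κ • w) = 0 :=
  (E.red_eq_zero_iff _).2 ⟨w, rfl⟩

theorem exists_lift {s : Π x, V x} (hs : s ∈ testSections n F V) : ∃ w, E.red w = s := by
  rw [← E.range_red] at hs
  exact hs

theorem red_mem (w : W) : E.red w ∈ testSections n F V := by
  rw [← E.range_red]
  exact ⟨w, rfl⟩

theorem red_ad (a : A) (w : W) : E.red (B.ad a w) = 0 := by
  simp only [BimoduleStr.ad, LinearMap.smul_apply, LinearMap.sub_apply]
  rw [E.red_smul, map_sub]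
  funext x
  simp [E.red_left, E.red_right]

theorem exists_ad_eq (E : BimoduleDeformation 𝒟 F V B) (a : A) (w : W) :
    ∃ w', B.ad a w = 𝒟.κ • w' :=
  (E.red_eq_zero_iff _).1 (E.red_ad a w)

theorem exists_add_of_red_eq {w v : W} (h : E.red w = E.red v) : ∃ u, w = v + 𝒟.κ • u := by
  obtain ⟨u, hu⟩ := (E.red_eq_zero_iff (w - v)).1 (by rw [map_sub, h, sub_self])
  exact ⟨u, by rw [← hu]; abel⟩

/-- `κ` can be cancelled modulo `κ`. -/
theorem red_eq_of_κ_smul_eq {w v u : W} (h : 𝒟.κ • w = 𝒟.κ • v + 𝒟.κ ^ 2 • u) :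
    E.red w = E.red v := by
  obtain ⟨t, ht⟩ := E.free.exists_eq_smul (w := w - v) (e := u) (by
    rw [pow_two, mul_smul, smul_sub, h]
    module)
  rw [← sub_eq_zero, ← map_sub, ht, E.red_κ_smul]

/-- `κ²` can be cancelled modulo `κ`. -/
theorem red_eq_of_κ_sq_smul_eq {w v : W} (h : 𝒟.κ ^ 2 • w = 𝒟.κ ^ 2 • v) :
    E.red w = E.red v := by
  obtain ⟨t, ht⟩ := E.free.exists_eq_smul (w := w - v) (e := 0) (by rw [smul_sub, h]; simp)
  rw [← sub_eq_zero, ← map_sub, ht, E.red_κ_smul]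

/-- Changing either lift by a multiple of `κ` changes `ad a w` by a multiple of `κ²`, since `ad`
itself takes values in `κ W`. So the connection does not depend on the lifts. -/
theorem red_eq_of_ad_eq {a a' : A} {w w' v v' e e' : W} (ha : 𝒟.red a = 𝒟.red a')
    (hw : E.red w = E.red w') (hv : B.ad a w = 𝒟.κ • v + 𝒟.κ ^ 2 • e)
    (hv' : B.ad a' w' = 𝒟.κ • v' + 𝒟.κ ^ 2 • e') : E.red v = E.red v' := by
  obtain ⟨u, rfl⟩ := E.exists_add_of_red_eq hw
  obtain ⟨c, hc⟩ := (𝒟.red_eq_zero_iff (a - a')).1 (by rw [map_sub, ha, sub_self])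
  obtain rfl : a = a' + 𝒟.κ • c := by rw [← hc]; abel
  obtain ⟨p, hp⟩ := E.exists_ad_eq a' u
  obtain ⟨q, hq⟩ := E.exists_ad_eq c (w' + 𝒟.κ • u)
  refine E.red_eq_of_κ_smul_eq (u := e' + p + q - e) ?_
  rw [B.ad_add, B.ad_smul, LinearMap.add_apply, LinearMap.smul_apply, hq, map_add, map_smul, hv',
    hp] at hv
  rw [← sub_eq_iff_eq_add.2 hv]
  module

/-- The contravariant connection `(f, s) ↦ D_f s` on test sections which is defined by
`κ D_f s = i [a, w] mod κ²` for `f = a mod κ` and `s = w mod κ`. -/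
def conn (f : M → ℂ) (s : Π x, V x) : Π x, V x :=
  -- The default `0` is irrelevant: a test function and a test section always have lifts, and the
  -- value does not depend on them.
  open Classical in
  if h : ∃ (v w : W) (a : A), 𝒟.red a = f ∧ E.red w = s ∧ B.ad a w = 𝒟.κ • v then
    E.red h.choose else 0

theorem conn_red {a : A} {w v : W} (h : ∃ e, B.ad a w = 𝒟.κ • v + 𝒟.κ ^ 2 • e) :
    E.conn (𝒟.red a) (E.red w) = E.red v := by
  obtain ⟨v', hv'⟩ := E.exists_ad_eq a w
  have hex : ∃ (v w' : W) (a' : A), 𝒟.red a' = 𝒟.red a ∧ E.red w' = E.red w ∧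
      B.ad a' w' = 𝒟.κ • v := ⟨v', w, a, rfl, rfl, hv'⟩
  obtain ⟨w', a', ha', hw', had⟩ := hex.choose_spec
  obtain ⟨e, he⟩ := h
  rw [conn, dif_pos hex]
  exact E.red_eq_of_ad_eq (e := 0) ha' hw' (by rw [had]; simp) he

theorem conn_red' {a : A} {w v : W} (h : B.ad a w = 𝒟.κ • v) :
    E.conn (𝒟.red a) (E.red w) = E.red v :=
  E.conn_red ⟨0, by rw [h]; simp⟩

theorem conn_mem (f : M → ℂ) (s : Π x, V x) (hf : f ∈ testFunctions n M)
    (hs : s ∈ testSections n F V) : E.conn f s ∈ testSections n F V := by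
  obtain ⟨a, rfl⟩ := 𝒟.exists_lift hf
  obtain ⟨w, rfl⟩ := E.exists_lift hs
  obtain ⟨v, hv⟩ := E.exists_ad_eq a w
  rw [E.conn_red' hv]
  exact E.red_mem v

theorem conn_add {f : M → ℂ} {s t : Π x, V x} (hf : f ∈ testFunctions n M)
    (hs : s ∈ testSections n F V) (ht : t ∈ testSections n F V) :
    E.conn f (s + t) = E.conn f s + E.conn f t := by
  obtain ⟨a, rfl⟩ := 𝒟.exists_lift hf
  obtain ⟨w, rfl⟩ := E.exists_lift hs
  obtain ⟨w', rfl⟩ := E.exists_lift ht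
  obtain ⟨v, hv⟩ := E.exists_ad_eq a w
  obtain ⟨v', hv'⟩ := E.exists_ad_eq a w'
  rw [E.conn_red' hv, E.conn_red' hv', ← map_add, ← map_add]
  exact E.conn_red' (by rw [map_add, hv, hv', smul_add])

theorem conn_add_left {f h : M → ℂ} {s : Π x, V x} (hf : f ∈ testFunctions n M)
    (hh : h ∈ testFunctions n M) (hs : s ∈ testSections n F V) :
    E.conn (f + h) s = E.conn f s + E.conn h s := by
  obtain ⟨a, rfl⟩ := 𝒟.exists_lift hf
  obtain ⟨b, rfl⟩ := 𝒟.exists_lift hh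
  obtain ⟨w, rfl⟩ := E.exists_lift hs
  obtain ⟨v, hv⟩ := E.exists_ad_eq a w
  obtain ⟨v', hv'⟩ := E.exists_ad_eq b w
  rw [E.conn_red' hv, E.conn_red' hv', ← map_add, ← map_add]
  exact E.conn_red' (by rw [B.ad_add, LinearMap.add_apply, hv, hv', smul_add])

theorem conn_smul_left {f : M → ℂ} {s : Π x, V x} (z : ℂ) (hf : f ∈ testFunctions n M)
    (hs : s ∈ testSections n F V) : E.conn (z • f) s = z • E.conn f s := by
  obtain ⟨a, rfl⟩ := 𝒟.exists_lift hf
  obtain ⟨w, rfl⟩ := E.exists_lift hs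
  obtain ⟨v, hv⟩ := E.exists_ad_eq a w
  rw [E.conn_red' hv, ← E.red_smul, ← 𝒟.red_smul]
  exact E.conn_red' (by rw [B.ad_smul, LinearMap.smul_apply, hv, smul_comm])

variable [IsManifold (𝓡 n) ∞ M]

/-- The Poisson bracket `{f, h} = π(df, dh)`. -/
def _root_.BivectorField.bracket (P : BivectorField n M) (f h : M → ℂ) (x : M) : ℂ :=
  P.complexify x (dC n f x) (dC n h x)

variable {P : BivectorField n M}

theorem _root_.SmoothDeformation.IsPoissonField.red_eq (hP : 𝒟.IsPoissonField P) {a b c : A}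
    (h : (BimoduleStr.self K A).ad a b = 𝒟.κ • c) :
    𝒟.red c = P.bracket (𝒟.red a) (𝒟.red b) := by
  funext x
  exact hP a b c ⟨0, by rw [← BimoduleStr.ad_self_apply, h]; simp⟩ x

theorem _root_.SmoothDeformation.IsPoissonField.bracket_mem (hP : 𝒟.IsPoissonField P)
    {f h : M → ℂ} (hf : f ∈ testFunctions n M) (hh : h ∈ testFunctions n M) :
    P.bracket f h ∈ testFunctions n M := by
  obtain ⟨a, rfl⟩ := 𝒟.exists_lift hf
  obtain ⟨b, rfl⟩ := 𝒟.exists_lift hh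
  obtain ⟨c, hc⟩ := 𝒟.exists_ad_eq a b
  rw [← hP.red_eq hc]
  exact 𝒟.red_mem c

/-- The Jacobi identity for the Poisson bracket of a deformation. -/
theorem _root_.SmoothDeformation.IsPoissonField.jacobi (hP : 𝒟.IsPoissonField P)
    {f h k : M → ℂ} (hf : f ∈ testFunctions n M) (hh : h ∈ testFunctions n M)
    (hk : k ∈ testFunctions n M) :
    P.bracket f (P.bracket h k) - P.bracket h (P.bracket f k) = P.bracket (P.bracket f h) k := by
  obtain ⟨a, rfl⟩ := 𝒟.exists_lift hf
  obtain ⟨b, rfl⟩ := 𝒟.exists_lift hh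
  obtain ⟨c, rfl⟩ := 𝒟.exists_lift hk
  obtain ⟨ab, hab⟩ := 𝒟.exists_ad_eq a b
  obtain ⟨bc, hbc⟩ := 𝒟.exists_ad_eq b c
  obtain ⟨ac, hac⟩ := 𝒟.exists_ad_eq a c
  obtain ⟨p, hp⟩ := 𝒟.exists_ad_eq a bc
  obtain ⟨q, hq⟩ := 𝒟.exists_ad_eq b ac
  obtain ⟨r, hr⟩ := 𝒟.exists_ad_eq ab c
  rw [← hP.red_eq hab, ← hP.red_eq hbc, ← hP.red_eq hac, ← hP.red_eq hp, ← hP.red_eq hq,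
    ← hP.red_eq hr, ← sub_eq_zero, ← map_sub, ← map_sub]
  have key := congrArg (fun T => T c) ((BimoduleStr.self K A).ad_comm a b)
  simp only [LinearMap.sub_apply, Module.End.mul_apply] at key
  rw [← BimoduleStr.ad_self_apply, hab, hbc, hac, map_smul, map_smul, hp, hq, BimoduleStr.ad_smul,
    LinearMap.smul_apply, hr] at key
  -- The Jacobi identity for commutators has become `κ² (p - q - r) = 0`, so `p - q - r` is
  -- divisible by `κ`.
  obtain ⟨t, ht⟩ := 𝒟.free.exists_eq_smul (w := p - q - r) (e := 0) (by
    rw [smul_zero, pow_two, mul_smul, smul_sub, smul_sub, smul_sub, smul_sub, key, sub_self])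
  rw [ht, 𝒟.red_κ_smul]

theorem conn_leibniz (hP : 𝒟.IsPoissonField P) {f h : M → ℂ} {s : Π x, V x}
    (hf : f ∈ testFunctions n M) (hh : h ∈ testFunctions n M) (hs : s ∈ testSections n F V) :
    E.conn f (fun x => h x • s x) = fun x => P.bracket f h x • s x + h x • E.conn f s x := by
  obtain ⟨a, rfl⟩ := 𝒟.exists_lift hf
  obtain ⟨b, rfl⟩ := 𝒟.exists_lift hh
  obtain ⟨w, rfl⟩ := E.exists_lift hs
  obtain ⟨v, hv⟩ := E.exists_ad_eq a w
  obtain ⟨c, hc⟩ := 𝒟.exists_ad_eq a b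
  have h1 : (fun x => 𝒟.red b x • E.red w x) = E.red (B.left b w) :=
    funext fun x => (E.red_left b w x).symm
  rw [h1, ← hP.red_eq hc, E.conn_red' hv, E.conn_red' (v := B.left c w + B.left b v)]
  · funext x
    rw [map_add, Pi.add_apply, E.red_left, E.red_left]
  · have := congrArg (fun T => T w) (B.ad_left a b)
    simp only [LinearMap.add_apply, Module.End.mul_apply] at this
    rw [this, ← BimoduleStr.ad_self_apply, hc, hv, map_smul, map_smul, LinearMap.smul_apply,
      smul_add]

/-- The contravariant connection is flat. -/
theorem conn_conn_sub (hP : 𝒟.IsPoissonField P) {f h : M → ℂ} {s : Π x, V x}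
    (hf : f ∈ testFunctions n M) (hh : h ∈ testFunctions n M) (hs : s ∈ testSections n F V) :
    E.conn f (E.conn h s) - E.conn h (E.conn f s) = E.conn (P.bracket f h) s := by
  obtain ⟨a, rfl⟩ := 𝒟.exists_lift hf
  obtain ⟨b, rfl⟩ := 𝒟.exists_lift hh
  obtain ⟨w, rfl⟩ := E.exists_lift hs
  obtain ⟨ab, hab⟩ := 𝒟.exists_ad_eq a b
  obtain ⟨wa, hwa⟩ := E.exists_ad_eq a w
  obtain ⟨wb, hwb⟩ := E.exists_ad_eq b w
  obtain ⟨p, hp⟩ := E.exists_ad_eq a wb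
  obtain ⟨q, hq⟩ := E.exists_ad_eq b wa
  obtain ⟨r, hr⟩ := E.exists_ad_eq ab w
  rw [← hP.red_eq hab, E.conn_red' hwa, E.conn_red' hwb, E.conn_red' hp, E.conn_red' hq,
    E.conn_red' hr, ← map_sub]
  have key := congrArg (fun T => T w) (B.ad_comm a b)
  simp only [LinearMap.sub_apply, Module.End.mul_apply] at key
  rw [← BimoduleStr.ad_self_apply, hab, hwa, hwb, map_smul, map_smul, hp, hq, BimoduleStr.ad_smul,
    LinearMap.smul_apply, hr] at key
  -- Two nested commutators produce `κ²`, which is why the deformation has to be free modulo `κ³`.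
  exact E.red_eq_of_κ_sq_smul_eq (by rw [pow_two, mul_smul, mul_smul, smul_sub, smul_sub, key])

end BimoduleDeformation

end Connection

end

/-! ### Complexified Clifford relations and compatibility of the connection with the metric. -/

section

section Cometric

variable {n : ℕ} {M : Type*} [TopologicalSpace M]
  [ChartedSpace (EuclideanSpace ℝ (Fin n)) M]

theorem covRe_add {x : M} (α β : CotangentC n M x) : covRe (α + β) = covRe α + covRe β :=
  ContinuousLinearMap.comp_add _ _ _

theorem covIm_add {x : M} (α β : CotangentC n M x) : covIm (α + β) = covIm α + covIm β :=
  ContinuousLinearMap.comp_add _ _ _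

theorem covRe_smul {x : M} (z : ℂ) (α : CotangentC n M x) :
    covRe (z • α) = z.re • covRe α - z.im • covIm α :=
  ContinuousLinearMap.ext fun v => Complex.mul_re z (α v)

theorem covIm_smul {x : M} (z : ℂ) (α : CotangentC n M x) :
    covIm (z • α) = z.re • covIm α + z.im • covRe α :=
  ContinuousLinearMap.ext fun v => Complex.mul_im z (α v)

variable [IsManifold (𝓡 n) ∞ M] (g : RiemMetric n M)

theorem cometric_smul_left (x : M) (c : ℝ) (α β : Cotangent n x) :
    cometric g x (c • α) β = c * cometric g x α β := by
  simp [cometric]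

theorem cometric_smul_right (x : M) (c : ℝ) (α β : Cotangent n x) :
    cometric g x α (c • β) = c * cometric g x α β := by
  simp [cometric]

theorem cometric_comm (x : M) (α β : Cotangent n x) : cometric g x α β = cometric g x β α := by
  obtain ⟨u, rfl⟩ := (lowerEquiv g x).surjective α
  obtain ⟨v, rfl⟩ := (lowerEquiv g x).surjective β
  simp only [cometric, LinearEquiv.symm_apply_apply, lowerEquiv_apply, g.symm]

theorem cometric_self_pos (x : M) {α : Cotangent n x} (hα : α ≠ 0) : 0 < cometric g x α α := by
  obtain ⟨u, rfl⟩ := (lowerEquiv g x).surjective α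
  simp only [cometric, LinearEquiv.symm_apply_apply, lowerEquiv_apply]
  exact g.pos x u fun h => hα (by rw [h, map_zero])

/-- The complex-bilinear extension of the cometric to complex covectors. -/
def cometricC (x : M) (α β : CotangentC n M x) : ℂ :=
  ⟨cometric g x (covRe α) (covRe β) - cometric g x (covIm α) (covIm β),
    cometric g x (covRe α) (covIm β) + cometric g x (covIm α) (covRe β)⟩

variable {g} {F : Type*} [NormedAddCommGroup F] [NormedSpace ℂ F]
  {V : M → Type*} [TopologicalSpace (TotalSpace F V)] [∀ x, TopologicalSpace (V x)]
  [∀ x, AddCommGroup (V x)] [∀ x, Module ℂ (V x)] [FiberBundle F V] (S : CliffordBundle g F V)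

namespace CliffordBundle

theorem mulC_add_left (x : M) (α β : CotangentC n M x) (v : V x) :
    S.mulC x (α + β) v = S.mulC x α v + S.mulC x β v := by
  simp only [mulC, covRe_add, covIm_add, map_add, LinearMap.add_apply]
  module

theorem mulC_smul_left (x : M) (z : ℂ) (α : CotangentC n M x) (v : V x) :
    S.mulC x (z • α) v = z • S.mulC x α v := by
  have h : ∀ (c : ℝ) (u : V x), c • u = (c : ℂ) • u := fun _ _ => rfl
  simp only [mulC, covRe_smul, covIm_smul, map_add, map_sub, map_smul, LinearMap.add_apply,
    LinearMap.sub_apply, LinearMap.smul_apply, h]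
  conv_rhs => rw [← z.re_add_im]
  linear_combination (norm := module) (-z.im : ℂ) • (Complex.I_mul_I • S.c x (covIm α) v)

theorem mulC_smul_right (x : M) (z : ℂ) (α : CotangentC n M x) (v : V x) :
    S.mulC x α (z • v) = z • S.mulC x α v := by
  simp only [mulC, map_smul]
  module

theorem mulC_zero_left (x : M) (v : V x) : S.mulC x 0 v = 0 := by
  simp [mulC, covRe, covIm]

theorem mulC_mulC_add (x : M) (α β : CotangentC n M x) (v : V x) :
    S.mulC x α (S.mulC x β v) + S.mulC x β (S.mulC x α v) = (2 * cometricC g x α β) • v := by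
  have h : ∀ α β : Cotangent n x, S.c x α (S.c x β v) =
      ((2 * cometric g x α β : ℝ) : ℂ) • v - S.c x β (S.c x α v) := fun α β => by
    rw [eq_sub_iff_add_eq]
    exact congrArg (fun T => T v) (S.clifford x α β)
  have hz : cometricC g x α β =
      ((cometric g x (covRe α) (covRe β) - cometric g x (covIm α) (covIm β) : ℝ) : ℂ) +
        ((cometric g x (covRe α) (covIm β) + cometric g x (covIm α) (covRe β) : ℝ) : ℂ) *
          Complex.I := by
    apply Complex.ext <;> simp [cometricC]
  simp only [mulC, map_add, map_smul]
  rw [h (covRe α) (covRe β), h (covRe α) (covIm β), h (covIm α) (covRe β), h (covIm α) (covIm β),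
    hz]
  push_cast
  linear_combination (norm := module)
    (2 * cometric g x (covIm α) (covIm β) : ℂ) • (Complex.I_mul_I • v)

end CliffordBundle

end Cometric

namespace DeformedSpectralTriple

variable {n : ℕ} {M : Type*} [TopologicalSpace M]
  [ChartedSpace (EuclideanSpace ℝ (Fin n)) M] [IsManifold (𝓡 n) ∞ M] {g : RiemMetric n M}
  {F : Type*} [NormedAddCommGroup F] [NormedSpace ℂ F]
  {V : M → Type*} [TopologicalSpace (TotalSpace F V)] [∀ x, TopologicalSpace (V x)]
  [∀ x, AddCommGroup (V x)] [∀ x, Module ℂ (V x)] [FiberBundle F V]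
  {K A W : Type*} [CommRing K] [Algebra ℂ K]
  [NonUnitalRing A] [Module K A] [IsScalarTower K A A] [SMulCommClass K A A]
  [AddCommGroup W] [Module K W]
  (T : DeformedSpectralTriple g F V K A W) {P : BivectorField n M}

theorem red_d' (a : A) : T.oneForms.red (T.bimodule.d T.D a) = dC n (T.deformation.red a) :=
  funext fun x => T.red_d a x

theorem dC_mem (T : DeformedSpectralTriple g F V K A W) {f : M → ℂ} (hf : f ∈ testFunctions n M) :
    dC n f ∈ testSections n (EuclideanSpace ℝ (Fin n) →L[ℝ] ℂ) (CotangentC n M) := by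
  obtain ⟨a, rfl⟩ := T.deformation.exists_lift hf
  rw [← T.red_d']
  exact T.oneForms.red_mem _

/-- The contravariant connection on `1`-forms is torsion free. -/
theorem conn_dC_sub (hP : T.deformation.IsPoissonField P) {f h : M → ℂ}
    (hf : f ∈ testFunctions n M) (hh : h ∈ testFunctions n M) :
    T.oneForms.conn f (dC n h) - T.oneForms.conn h (dC n f) = dC n (P.bracket f h) := by
  obtain ⟨a, rfl⟩ := T.deformation.exists_lift hf
  obtain ⟨b, rfl⟩ := T.deformation.exists_lift hh
  obtain ⟨c, hc⟩ := T.deformation.exists_ad_eq a b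
  obtain ⟨p, hp⟩ := T.oneForms.exists_ad_eq a (T.bimodule.d T.D b)
  obtain ⟨q, hq⟩ := T.oneForms.exists_ad_eq b (T.bimodule.d T.D a)
  rw [← hP.red_eq hc, ← T.red_d', ← T.red_d', ← T.red_d', T.oneForms.conn_red' hp,
    T.oneForms.conn_red' hq, ← map_sub]
  refine T.oneForms.red_eq_of_κ_smul_eq (u := 0) ?_
  rw [smul_zero, add_zero, smul_sub, ← hp, ← hq, T.bimodule.ad_d, ← BimoduleStr.ad_self_apply, hc,
    BimoduleStr.d_smul]

/-- Links the two reductions of a noncommutative form, as an operator on `W` and as a class in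
`Ω¹_D`. For a commutator `[D, a]` it is the symbol formula of the Dirac-type operator, and the
property survives the bimodule operations that generate `Ω¹_D`. -/
theorem red_forms_apply (hT : ∀ x : M, ∃ f ∈ testFunctions n M, f x = 1)
    {S : Module.End K W} (hS : S ∈ T.bimodule.forms T.D) (w : W) (x : M) :
    T.sections.red (S w) x = T.spin.mulC x (T.oneForms.red ⟨S, hS⟩ x) (T.sections.red w x) := by
  let Q : Submodule K (Module.End K W) :=
    { carrier := {S | ∃ hS : S ∈ T.bimodule.forms T.D, ∀ w x, T.sections.red (S w) x =
        T.spin.mulC x (T.oneForms.red ⟨S, hS⟩ x) (T.sections.red w x)}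
      zero_mem' := by
        refine ⟨Submodule.zero_mem _, fun w x => ?_⟩
        have h0 : (⟨0, Submodule.zero_mem _⟩ : T.bimodule.forms T.D) = 0 := rfl
        rw [LinearMap.zero_apply, map_zero, h0, map_zero, Pi.zero_apply, Pi.zero_apply,
          T.spin.mulC_zero_left]
      add_mem' := by
        rintro S S' ⟨hS, h⟩ ⟨hS', h'⟩
        refine ⟨Submodule.add_mem _ hS hS', fun w x => ?_⟩
        have h0 : (⟨S + S', Submodule.add_mem _ hS hS'⟩ : T.bimodule.forms T.D) =
          ⟨S, hS⟩ + ⟨S', hS'⟩ := rfl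
        rw [h0, LinearMap.add_apply, map_add, map_add, Pi.add_apply, Pi.add_apply,
          T.spin.mulC_add_left, h, h']
      smul_mem' := by
        rintro k S ⟨hS, h⟩
        refine ⟨Submodule.smul_mem _ k hS, fun w x => ?_⟩
        -- The reductions are only assumed `ℂ`-linear. A lift `b` of a function equal to one at `x`
        -- turns the scalar `k` into `k • b` in `A`, which acts at `x` by the same number on both
        -- sides.
        obtain ⟨f, hf, hfx⟩ := hT x
        obtain ⟨b, rfl⟩ := T.deformation.exists_lift hf
        have h1 : T.sections.red (k • S w) x =
            T.deformation.red (k • b) x • T.sections.red (S w) x := by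
          rw [← T.sections.red_left, T.bimodule.left.map_smul, LinearMap.smul_apply,
            ← (T.bimodule.left b).map_smul,
            T.sections.red_left, hfx, one_smul]
        have h2 : T.oneForms.red ⟨k • S, Submodule.smul_mem _ k hS⟩ x =
            T.deformation.red (k • b) x • T.oneForms.red ⟨S, hS⟩ x := by
          rw [← T.oneForms.red_left, map_smul, LinearMap.smul_apply, ← LinearMap.map_smul,
            T.oneForms.red_left, hfx, one_smul]
          rfl
        rw [LinearMap.smul_apply, h1, h2, T.spin.mulC_smul_left, h] }
  have hQ : T.bimodule.forms T.D ≤ Q := by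
    refine sInf_le ⟨fun a => ⟨T.bimodule.commD_mem T.D a, fun w x => ?_⟩, fun a S ⟨hS, h⟩ =>
      ⟨⟨T.bimodule.left_mem T.D a hS, fun w x => ?_⟩,
        ⟨T.bimodule.right_mem T.D a hS, fun w x => ?_⟩⟩⟩
    · have h1 : T.oneForms.red ⟨T.bimodule.commD T.D a, T.bimodule.commD_mem T.D a⟩ x =
          Complex.I • dC n (T.deformation.red a) x := by
        rw [← T.red_d, BimoduleStr.d, T.oneForms.red_smul, Pi.smul_apply, smul_smul]
        simp
      have h2 : T.sections.red (T.bimodule.left a w) =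
          fun y => T.deformation.red a y • T.sections.red w y :=
        funext fun y => T.sections.red_left a w y
      rw [h1, T.spin.mulC_smul_left, BimoduleStr.commD, LinearMap.sub_apply, Module.End.mul_apply,
        Module.End.mul_apply, map_sub, Pi.sub_apply, T.sections.red_left, T.red_D, T.red_D, h2,
        T.isDiracType.leibniz _ (T.deformation.red_mem a) _ (T.sections.red_mem w)]
      abel
    · have h1 := T.oneForms.red_left a ⟨S, hS⟩ x
      rw [Module.End.mul_apply, T.sections.red_left, h, ← T.spin.mulC_smul_left, ← h1]
      rfl
    · have h1 := T.oneForms.red_right a ⟨S, hS⟩ x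
      rw [Module.End.mul_apply, h, T.sections.red_left, T.spin.mulC_smul_right,
        ← T.spin.mulC_smul_left, ← h1]
      rfl
  obtain ⟨_, h⟩ := hQ hS
  exact h w x

/-- The commutant of right multiplication is closed under left multiplication by `A` on either side,
so it contains `Ω¹_D` once it contains the generators. -/
theorem forms_commute_right {S : Module.End K W} (hS : S ∈ T.bimodule.forms T.D) (b : A) :
    S * T.bimodule.right b = T.bimodule.right b * S := by
  let Q : Submodule K (Module.End K W) :=
    { carrier := {S | S * T.bimodule.right b = T.bimodule.right b * S}
      zero_mem' := by simp
      add_mem' := fun {S S'} h h' => by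
        simp only [Set.mem_ofPred_eq] at h h' ⊢
        rw [add_mul, mul_add, h, h']
      smul_mem' := fun k S h => by
        simp only [Set.mem_ofPred_eq] at h ⊢
        rw [smul_mul_assoc, mul_smul_comm, h] }
  have hQ : T.bimodule.forms T.D ≤ Q := by
    refine sInf_le ⟨fun a => T.commD_right a b, fun a S (h : S * _ = _ * S) => ⟨?_, ?_⟩⟩
    · change T.bimodule.left a * S * T.bimodule.right b =
        T.bimodule.right b * (T.bimodule.left a * S)
      rw [mul_assoc, h, ← mul_assoc, ← T.bimodule.assoc, mul_assoc]
    · change S * T.bimodule.left a * T.bimodule.right b =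
        T.bimodule.right b * (S * T.bimodule.left a)
      rw [mul_assoc, ← T.bimodule.assoc, ← mul_assoc, h, mul_assoc]
  exact hQ hS

/-- The contravariant connection on `1`-forms is compatible with the metric. -/
theorem bracket_cometricC (hT : ∀ x : M, ∃ f ∈ testFunctions n M, f x = 1)
    (hV : ∀ x : M, ∃ s ∈ testSections n F V, s x ≠ 0)
    (hP : T.deformation.IsPoissonField P) {f : M → ℂ} {σ τ : Π x, CotangentC n M x}
    (hf : f ∈ testFunctions n M)
    (hσ : σ ∈ testSections n (EuclideanSpace ℝ (Fin n) →L[ℝ] ℂ) (CotangentC n M))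
    (hτ : τ ∈ testSections n (EuclideanSpace ℝ (Fin n) →L[ℝ] ℂ) (CotangentC n M))
    (hg : (fun x => cometricC g x (σ x) (τ x)) ∈ testFunctions n M) (x : M) :
    P.bracket f (fun x => cometricC g x (σ x) (τ x)) x =
      cometricC g x (T.oneForms.conn f σ x) (τ x) +
        cometricC g x (σ x) (T.oneForms.conn f τ x) := by
  obtain ⟨s, hs, hsx⟩ := hV x
  obtain ⟨w, rfl⟩ := T.sections.exists_lift hs
  obtain ⟨a, rfl⟩ := T.deformation.exists_lift hf
  obtain ⟨q, hq⟩ := T.deformation.exists_lift hg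
  obtain ⟨S, rfl⟩ := T.oneForms.exists_lift hσ
  obtain ⟨R, rfl⟩ := T.oneForms.exists_lift hτ
  obtain ⟨S', hS'⟩ := T.oneForms.exists_ad_eq a S
  obtain ⟨R', hR'⟩ := T.oneForms.exists_ad_eq a R
  obtain ⟨q', hq'⟩ := T.deformation.exists_ad_eq a q
  rw [T.oneForms.conn_red' hS', T.oneForms.conn_red' hR', ← hq, ← hP.red_eq hq']
  let B := T.bimodule
  -- `Y` is the defect of the Clifford relation between the lifts, and `Z` is what remains of `i [a,
  -- Y]` after division by `κ`.
  let Y : Module.End K W := S * R + R * S - B.left q - B.left q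
  let Z : Module.End K W := S' * R + R * S' + (S * R' + R' * S) - B.left q' - B.left q'
  let i := algebraMap ℂ K Complex.I
  let κ := T.deformation.κ
  have hcl : ∀ (S R : B.forms T.D) (w : W) (x : M),
      T.sections.red (((S * R + R * S : Module.End K W)) w) x =
        (2 * cometricC g x (T.oneForms.red S x) (T.oneForms.red R x)) • T.sections.red w x := by
    intro S R w x
    rw [LinearMap.add_apply, Module.End.mul_apply, Module.End.mul_apply, map_add, Pi.add_apply,
      T.red_forms_apply hT S.2, T.red_forms_apply hT R.2, T.red_forms_apply hT R.2,
      T.red_forms_apply hT S.2, T.spin.mulC_mulC_add]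
  have hYred : ∀ w, ∃ u, Y w = κ • u := by
    intro w
    refine (T.sections.red_eq_zero_iff _).1 (funext fun y => ?_)
    have h2 := congrFun hq y
    simp only [Y]
    rw [LinearMap.sub_apply, LinearMap.sub_apply, map_sub, map_sub, Pi.sub_apply, Pi.sub_apply,
      hcl, T.sections.red_left, h2, Pi.zero_apply]
    module
  have hZY : κ • Z = i • (B.left a * Y - Y * B.left a) := by
    have h1 : i • (B.left a * S - S * B.left a : Module.End K W) = κ • (S' : Module.End K W) :=
      congrArg Subtype.val hS'
    have h2 : i • (B.left a * R - R * B.left a : Module.End K W) = κ • (R' : Module.End K W) :=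
      congrArg Subtype.val hR'
    have h3 : i • (B.left a * B.left q - B.left q * B.left a) = κ • B.left q' := by
      rw [← B.left_mul, ← B.left_mul, ← map_sub, ← map_smul, ← map_smul]
      exact congrArg B.left hq'
    calc κ • Z = (κ • (S' : Module.End K W)) * R + R * (κ • (S' : Module.End K W)) +
          (S * (κ • (R' : Module.End K W)) + (κ • (R' : Module.End K W)) * S) -
          κ • B.left q' - κ • B.left q' := by
            simp only [Z, smul_sub, smul_add, smul_mul_assoc, mul_smul_comm]
      _ = _ := by
            rw [← h1, ← h2, ← h3]
            simp only [Y, mul_sub, sub_mul, mul_add, add_mul, smul_sub, smul_add, smul_mul_assoc,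
              mul_smul_comm, mul_assoc]
            abel
  -- This lets the commutator with left multiplication by `a` be replaced by the commutator with `ad
  -- a`.
  have hYr : Y * B.right a = B.right a * Y := by
    have h1 := T.forms_commute_right S.2 a
    have h2 := T.forms_commute_right R.2 a
    simp only [Y, mul_sub, sub_mul, mul_add, add_mul]
    rw [mul_assoc, h2, ← mul_assoc, h1, mul_assoc, mul_assoc (R : Module.End K W) S, h1,
      ← mul_assoc (R : Module.End K W), h2, mul_assoc, B.assoc]
  obtain ⟨v, hv⟩ := T.sections.exists_ad_eq a w
  obtain ⟨u, hu⟩ := hYred w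
  obtain ⟨u', hu'⟩ := T.sections.exists_ad_eq a u
  obtain ⟨t, ht⟩ := hYred v
  -- In `κ Z w = ad a (Y w) - Y (ad a w)` both `Y` and `ad a` take values in `κ W`, so the right
  -- side is of order `κ²` and `Z w` vanishes modulo `κ`.
  have hZ : T.sections.red (Z w) = T.sections.red 0 := by
    refine T.sections.red_eq_of_κ_smul_eq (u := u' - t) ?_
    have h1 : κ • Z w = B.ad a (Y w) - Y (B.ad a w) := by
      have := congrArg (fun T => T w) hZY
      simp only [LinearMap.smul_apply, LinearMap.sub_apply, Module.End.mul_apply] at this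
      have hYrw : Y (B.right a w) = B.right a (Y w) := congrArg (fun T => T w) hYr
      rw [this]
      simp only [BimoduleStr.ad, LinearMap.smul_apply, LinearMap.sub_apply, map_smul, map_sub]
      rw [hYrw]
      module
    change κ • Z w = _
    rw [h1, hu, hv, map_smul, map_smul, hu', ht]
    module
  have hx := congrFun hZ x
  simp only [Z] at hx
  rw [LinearMap.sub_apply, LinearMap.sub_apply, LinearMap.add_apply, map_sub, map_sub, map_add,
    Pi.sub_apply, Pi.sub_apply, Pi.add_apply, hcl, hcl, T.sections.red_left, map_zero,
    Pi.zero_apply, ← add_smul, ← sub_smul, ← sub_smul] at hx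
  -- `Z w` reduces to a scalar function times the section; it is read off at a point where the
  -- section is nonzero.
  have h0 := (smul_eq_zero.1 hx).resolve_right hsx
  linear_combination (-1 / 2 : ℂ) * h0

end DeformedSpectralTriple

end

/-! ### Smooth and compactly supported vector fields and `1`-forms. -/

section

variable {n : ℕ} {M : Type*} [TopologicalSpace M]
  [ChartedSpace (EuclideanSpace ℝ (Fin n)) M]

/-- Smooth compactly supported vector fields. -/
abbrev testFields (n : ℕ) (M : Type*) [TopologicalSpace M]
    [ChartedSpace (EuclideanSpace ℝ (Fin n)) M] [IsManifold (𝓡 n) ∞ M] :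
    Set (Π x : M, TangentSpace (𝓡 n) x) :=
  testSections n (EuclideanSpace ℝ (Fin n)) (fun x : M => TangentSpace (𝓡 n) x)

/-- Smooth compactly supported real `1`-forms. -/
abbrev testForms (n : ℕ) (M : Type*) [TopologicalSpace M]
    [ChartedSpace (EuclideanSpace ℝ (Fin n)) M] [IsManifold (𝓡 n) ∞ M] :
    Set (Π x : M, TangentSpace (𝓡 n) x →L[ℝ] Trivial M ℝ x) :=
  testSections n (EuclideanSpace ℝ (Fin n) →L[ℝ] ℝ)
    (fun x : M => TangentSpace (𝓡 n) x →L[ℝ] Trivial M ℝ x)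

/-- Smooth compactly supported complex `1`-forms. -/
abbrev testFormsC (n : ℕ) (M : Type*) [TopologicalSpace M]
    [ChartedSpace (EuclideanSpace ℝ (Fin n)) M] [IsManifold (𝓡 n) ∞ M] :
    Set (Π x, CotangentC n M x) :=
  testSections n (EuclideanSpace ℝ (Fin n) →L[ℝ] ℂ) (CotangentC n M)

section Bundles

variable {F : Type*} [NormedAddCommGroup F] [NormedSpace ℝ F]

theorem isSmoothSection_trivial_iff {f : M → F} :
    IsSmoothSection n F (V := Trivial M F) f ↔ ContMDiff (𝓡 n) 𝓘(ℝ, F) ∞ f :=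
  forall_congr' fun _ => contMDiffAt_section _

variable [FiniteDimensional ℝ F] {V : M → Type*}
  [TopologicalSpace (TotalSpace F V)] [∀ x, AddCommGroup (V x)] [∀ x, Module ℝ (V x)]
  [∀ x, TopologicalSpace (V x)] [FiberBundle F V] [VectorBundle ℝ F V]
  [ContMDiffVectorBundle ∞ F V (𝓡 n)] [T2Space M] [IsManifold (𝓡 n) ∞ M]

/-- A combination of the cut-off frame with constant coefficients suffices. -/
theorem exists_mem_testSections_eq (x₀ : M) (v : V x₀) : ∃ s ∈ testSections n F V, s x₀ = v := by
  let e := trivializationAt F V x₀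
  have hx₀ : x₀ ∈ e.baseSet := FiberBundle.mem_baseSet_trivializationAt' x₀
  obtain ⟨ψ, hψ, hψ1, hψe⟩ := exists_isRealTest_bump (n := n) (e.open_baseSet.mem_nhds hx₀)
  let b := Module.finBasis ℝ F
  have hψx : ψ x₀ = 1 := hψ1.self_of_nhds
  refine ⟨∑ i, ((e.basisAt b hx₀).repr v i) • fun x => ψ x • e.localFrame b i x,
    sum_mem_testSections _ _ fun i _ => smul_mem_testSections contMDiff_const
      (cutoff_localFrame_mem_testSections b e hψ hψe i), ?_⟩
  simp only [Finset.sum_apply, Pi.smul_apply, hψx, one_smul,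
    e.localFrame_apply_of_mem_baseSet b hx₀]
  exact (e.basisAt b hx₀).sum_repr v

variable {F' : Type*} [NormedAddCommGroup F'] [NormedSpace ℝ F'] {V' : M → Type*}
  [TopologicalSpace (TotalSpace F' V')] [∀ x, AddCommGroup (V' x)] [∀ x, Module ℝ (V' x)]
  [∀ x, TopologicalSpace (V' x)] [∀ x, IsTopologicalAddGroup (V' x)]
  [∀ x, ContinuousSMul ℝ (V' x)] [FiberBundle F' V'] [VectorBundle ℝ F' V']

/-- A section of a bundle of homomorphisms is smooth if it maps test sections to smooth
sections. -/
theorem isSmoothSection_hom (φ : Π x, V x →L[ℝ] V' x)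
    (h : ∀ s ∈ testSections n F V, IsSmoothSection n F' fun x => φ x (s x)) :
    IsSmoothSection n (F →L[ℝ] F') (V := fun x => V x →L[ℝ] V' x) φ := by
  intro x₀
  refine contMDiffAt_hom_of_forall_exists φ fun v => ?_
  obtain ⟨s, hs, hsx⟩ := exists_mem_testSections_eq (n := n) (F := F) x₀ v
  exact ⟨s, hsx, hs.1 x₀, h s hs x₀⟩

end Bundles

theorem mem_testSections_of_forall {F F' : Type*} [NormedAddCommGroup F] [NormedSpace ℝ F]
    {V : M → Type*} [TopologicalSpace (TotalSpace F V)] [∀ x, TopologicalSpace (V x)]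
    [∀ x, Zero (V x)] [FiberBundle F V] [NormedAddCommGroup F'] [NormedSpace ℝ F']
    {V' : M → Type*} [TopologicalSpace (TotalSpace F' V')] [∀ x, TopologicalSpace (V' x)]
    [∀ x, Zero (V' x)] [FiberBundle F' V'] {s : Π x, V x} (hs : s ∈ testSections n F V)
    {t : Π x, V' x} (ht : IsSmoothSection n F' t) (h : ∀ x, s x = 0 → t x = 0) :
    t ∈ testSections n F' V' :=
  ⟨ht, hs.2.of_isClosed_subset isClosed_closure (closure_mono fun x hx hx' => hx (h x hx'))⟩

section Cotangent

variable [IsManifold (𝓡 n) ∞ M]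

theorem IsSmoothSection.form_apply {F : Type*} [NormedAddCommGroup F] [NormedSpace ℝ F]
    {σ : Π x : M, TangentSpace (𝓡 n) x →L[ℝ] Trivial M F x} {X : Π x : M, TangentSpace (𝓡 n) x}
    (hσ : IsSmoothSection n (EuclideanSpace ℝ (Fin n) →L[ℝ] F) σ)
    (hX : IsSmoothSection n (EuclideanSpace ℝ (Fin n)) X) :
    ContMDiff (𝓡 n) 𝓘(ℝ, F) ∞ (fun x => (σ x (X x) : F)) :=
  isSmoothSection_trivial_iff.1 (ContMDiff.clm_bundle_apply hσ hX)

theorem isSmoothSection_lowerEquiv (g : RiemMetric n M) {X : Π x : M, TangentSpace (𝓡 n) x}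
    (hX : IsSmoothSection n (EuclideanSpace ℝ (Fin n)) X) :
    IsSmoothSection n (EuclideanSpace ℝ (Fin n) →L[ℝ] ℝ)
      (V := fun x => TangentSpace (𝓡 n) x →L[ℝ] Trivial M ℝ x) fun x => lowerEquiv g x (X x) :=
  ContMDiff.clm_bundle_apply g.contMDiff hX

variable [T2Space M]

theorem isSmoothSection_form {F : Type*} [NormedAddCommGroup F] [NormedSpace ℝ F]
    (σ : Π x : M, TangentSpace (𝓡 n) x →L[ℝ] Trivial M F x)
    (h : ∀ X ∈ testFields n M, ContMDiff (𝓡 n) 𝓘(ℝ, F) ∞ (fun x => (σ x (X x) : F))) :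
    IsSmoothSection n (EuclideanSpace ℝ (Fin n) →L[ℝ] F) σ :=
  isSmoothSection_hom σ fun X hX => isSmoothSection_trivial_iff.2 (h X hX)

/-- The inverse of a smooth isomorphism between the tangent and the cotangent bundle is smooth. -/
theorem isSmoothSection_symm_apply (L : Π x : M, TangentSpace (𝓡 n) x ≃ₗ[ℝ] Cotangent n x)
    (hL : ∀ X ∈ testFields n M, IsSmoothSection n (EuclideanSpace ℝ (Fin n) →L[ℝ] ℝ)
      (V := fun x => TangentSpace (𝓡 n) x →L[ℝ] Trivial M ℝ x) fun x => L x (X x))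
    {σ : Π x : M, TangentSpace (𝓡 n) x →L[ℝ] Trivial M ℝ x}
    (hσ : IsSmoothSection n (EuclideanSpace ℝ (Fin n) →L[ℝ] ℝ) σ) :
    IsSmoothSection n (EuclideanSpace ℝ (Fin n)) fun x => (L x).symm (σ x) := by
  intro x₀
  have hfin : ∀ x : M, FiniteDimensional ℝ (TangentSpace (𝓡 n) x →L[ℝ] Trivial M ℝ x) := fun x =>
    inferInstanceAs (FiniteDimensional ℝ (EuclideanSpace ℝ (Fin n) →L[ℝ] ℝ))
  let φ : Π x : M, (TangentSpace (𝓡 n) x →L[ℝ] Trivial M ℝ x) →L[ℝ] TangentSpace (𝓡 n) x :=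
    fun x => LinearMap.toContinuousLinearMap ((L x).symm : Cotangent n x →ₗ[ℝ] TangentSpace (𝓡 n) x)
  -- The test sections are the forms `L X` with `X` a test field: they attain every covector at
  -- `x₀`, and the inverse sends them back to the smooth field `X`.
  have h := contMDiffAt_hom_of_forall_exists (n := n) (F₁ := EuclideanSpace ℝ (Fin n) →L[ℝ] ℝ)
    (F₂ := EuclideanSpace ℝ (Fin n)) φ (x₀ := x₀) fun β => by
      obtain ⟨X, hX, hXx⟩ := exists_mem_testSections_eq (n := n) (F := EuclideanSpace ℝ (Fin n))
        (V := fun x : M => TangentSpace (𝓡 n) x) x₀ ((L x₀).symm β)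
      refine ⟨fun x => L x (X x), ?_, hL X hX x₀, ?_⟩
      · change L x₀ (X x₀) = β
        rw [hXx]
        exact (L x₀).apply_symm_apply β
      · have h : ∀ x, φ x (L x (X x)) = X x := fun x => (L x).symm_apply_apply (X x)
        exact (hX.1 x₀).congr_of_eventuallyEq (.of_forall fun x => congrArg _ (h x))
  exact ContMDiffAt.clm_bundle_apply h (hσ x₀)

theorem contMDiff_cometric (g : RiemMetric n M)
    {σ τ : Π x : M, TangentSpace (𝓡 n) x →L[ℝ] Trivial M ℝ x}
    (hσ : IsSmoothSection n (EuclideanSpace ℝ (Fin n) →L[ℝ] ℝ) σ)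
    (hτ : IsSmoothSection n (EuclideanSpace ℝ (Fin n) →L[ℝ] ℝ) τ) :
    ContMDiff (𝓡 n) 𝓘(ℝ, ℝ) ∞ fun x => cometric g x (σ x) (τ x) :=
  hτ.form_apply (isSmoothSection_symm_apply (lowerEquiv g)
    (fun _ hX => isSmoothSection_lowerEquiv g hX.1) hσ)

/-- The complex `1`-form given by a real `1`-form. -/
def covC {x : M} (α : Cotangent n x) : CotangentC n M x := Complex.ofRealCLM.comp α

theorem isSmoothSection_covRe {σ : Π x : M, CotangentC n M x}
    (hσ : IsSmoothSection n (EuclideanSpace ℝ (Fin n) →L[ℝ] ℂ) σ) :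
    IsSmoothSection n (EuclideanSpace ℝ (Fin n) →L[ℝ] ℝ)
      (V := fun x => TangentSpace (𝓡 n) x →L[ℝ] Trivial M ℝ x) fun x => covRe (σ x) :=
  isSmoothSection_form _ fun _ hX => Complex.reCLM.contMDiff.comp (hσ.form_apply hX.1)

theorem isSmoothSection_covIm {σ : Π x : M, CotangentC n M x}
    (hσ : IsSmoothSection n (EuclideanSpace ℝ (Fin n) →L[ℝ] ℂ) σ) :
    IsSmoothSection n (EuclideanSpace ℝ (Fin n) →L[ℝ] ℝ)
      (V := fun x => TangentSpace (𝓡 n) x →L[ℝ] Trivial M ℝ x) fun x => covIm (σ x) :=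
  isSmoothSection_form _ fun _ hX => Complex.imCLM.contMDiff.comp (hσ.form_apply hX.1)

theorem isSmoothSection_covC {σ : Π x : M, TangentSpace (𝓡 n) x →L[ℝ] Trivial M ℝ x}
    (hσ : IsSmoothSection n (EuclideanSpace ℝ (Fin n) →L[ℝ] ℝ) σ) :
    IsSmoothSection n (EuclideanSpace ℝ (Fin n) →L[ℝ] ℂ)
      (V := CotangentC n M) fun x => covC (σ x) :=
  isSmoothSection_form _ fun _ hX => Complex.ofRealCLM.contMDiff.comp (hσ.form_apply hX.1)

theorem covC_mem {σ : Π x : M, TangentSpace (𝓡 n) x →L[ℝ] Trivial M ℝ x}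
    (hσ : σ ∈ testForms n M) : (fun x => covC (σ x)) ∈ testFormsC n M :=
  mem_testSections_of_forall hσ (isSmoothSection_covC hσ.1) fun x hx => by
    rw [hx]
    exact ContinuousLinearMap.comp_zero _

theorem covRe_mem {σ : Π x : M, CotangentC n M x} (hσ : σ ∈ testFormsC n M) :
    (fun x => covRe (σ x)) ∈ testForms n M :=
  mem_testSections_of_forall hσ (isSmoothSection_covRe hσ.1) fun x hx => by
    rw [hx]
    exact ContinuousLinearMap.comp_zero _

theorem cometricC_mem (g : RiemMetric n M) {σ τ : Π x : M, CotangentC n M x}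
    (hσ : σ ∈ testFormsC n M) (hτ : τ ∈ testFormsC n M) :
    (fun x => cometricC g x (σ x) (τ x)) ∈ testFunctions n M := by
  refine ⟨?_, hσ.2.of_isClosed_subset isClosed_closure (closure_mono fun x hx h => hx ?_)⟩
  · have h : (fun x => cometricC g x (σ x) (τ x)) = fun x =>
        Complex.equivRealProdCLM.symm
          ((cometric g x (covRe (σ x)) (covRe (τ x)) - cometric g x (covIm (σ x)) (covIm (τ x)),
            cometric g x (covRe (σ x)) (covIm (τ x)) + cometric g x (covIm (σ x)) (covRe (τ x))) :
            ℝ × ℝ) := by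
      funext x
      apply Complex.ext <;> simp [cometricC]
    rw [h]
    have h1 := isSmoothSection_covRe hσ.1
    have h2 := isSmoothSection_covIm hσ.1
    have h3 := isSmoothSection_covRe hτ.1
    have h4 := isSmoothSection_covIm hτ.1
    exact Complex.equivRealProdCLM.symm.toContinuousLinearMap.contMDiff.comp
      (((contMDiff_cometric g h1 h3).sub (contMDiff_cometric g h2 h4)).prodMk_space
        ((contMDiff_cometric g h1 h4).add (contMDiff_cometric g h2 h3)))
  · have h0 : covRe (σ x) = 0 := by rw [h]; exact ContinuousLinearMap.comp_zero _
    have h1 : covIm (σ x) = 0 := by rw [h]; exact ContinuousLinearMap.comp_zero _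
    apply Complex.ext <;> simp [cometricC, cometric, h0, h1]

end Cotangent

end

/-! ### The identification of vectors with covectors by the symplectic form, and the metric `g'`. -/

section

/-- Compactness of the unit sphere gives `c > 0` with `c ‖v‖² ≤ B v v`; an empty sphere does no
harm. -/
theorem isVonNBounded_of_pos {E : Type*} [NormedAddCommGroup E] [NormedSpace ℝ E]
    [FiniteDimensional ℝ E] (B : E →L[ℝ] E →L[ℝ] ℝ) (hB : ∀ v, v ≠ 0 → 0 < B v v) :
    Bornology.IsVonNBounded ℝ {v | B v v < 1} := by
  have hcont : Continuous fun v => B v v := B.continuous.clm_apply continuous_id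
  obtain ⟨c, hc, hcB⟩ := (isCompact_sphere (0 : E) 1).exists_forall_le' hcont.continuousOn
    (a := 0) fun v hv => hB v fun h => by simp [h] at hv
  rw [NormedSpace.isVonNBounded_iff, isBounded_iff_forall_norm_le]
  -- A bound without square roots: `‖v‖² ≤ 1 / c` and `2 ‖v‖ ≤ 1 + ‖v‖²`.
  refine ⟨1 + 1 / c, fun v (hv : B v v < 1) => ?_⟩
  have key : c * ‖v‖ ^ 2 ≤ B v v := by
    rcases eq_or_ne v 0 with rfl | h0
    · simp
    have hn : ‖v‖ ≠ 0 := norm_ne_zero_iff.2 h0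
    have := hcB (‖v‖⁻¹ • v) (by simp [norm_smul, hn])
    simp only [map_smul, smul_apply, smul_eq_mul] at this
    calc c * ‖v‖ ^ 2 ≤ (‖v‖⁻¹ * (‖v‖⁻¹ * B v v)) * ‖v‖ ^ 2 := by gcongr
      _ = B v v := by field_simp
  have h2 : ‖v‖ ^ 2 ≤ 1 / c := by
    rw [le_div_iff₀ hc]
    linarith
  nlinarith [sq_nonneg (‖v‖ - 1)]

variable {n : ℕ} {M : Type*} [TopologicalSpace M]
  [ChartedSpace (EuclideanSpace ℝ (Fin n)) M] [IsManifold (𝓡 n) ∞ M]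

namespace TwoForm

theorem neg_swap (Ω : TwoForm n M) (x : M) (u v : TangentSpace (𝓡 n) x) :
    -Ω.toFun x u v = Ω.toFun x v u := by
  have := Ω.alt x (u + v)
  simp only [map_add, add_apply, Ω.alt] at this
  linarith

variable {Ω : TwoForm n M} {P : BivectorField n M}

theorem IsInverseOf.apply_neg (hΩ : Ω.IsInverseOf P) (x : M) (u : TangentSpace (𝓡 n) x)
    (α : Cotangent n x) : P.toFun x (-Ω.toFun x u) α = α u :=
  hΩ x u α _ fun v => Ω.neg_swap x u v

/-- The isomorphism `u ↦ ω(·, u)` from the tangent to the cotangent space. -/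
def IsInverseOf.flat (hΩ : Ω.IsInverseOf P) (x : M) : TangentSpace (𝓡 n) x ≃ₗ[ℝ] Cotangent n x :=
  have : FiniteDimensional ℝ (TangentSpace (𝓡 n) x) :=
    inferInstanceAs (FiniteDimensional ℝ (EuclideanSpace ℝ (Fin n)))
  LinearEquiv.ofInjectiveOfFinrankEq (-Ω.toFun x : TangentSpace (𝓡 n) x →ₗ[ℝ] Cotangent n x)
    (by
      rw [← LinearMap.ker_eq_bot, LinearMap.ker_eq_bot']
      intro u hu
      -- If `ω(·, u) = 0` then `a u = π(0, a) = 0` for every covector, so `u = 0`.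
      have key : ∀ a : EuclideanSpace ℝ (Fin n) →L[ℝ] ℝ, a u = a 0 := fun a => by
        have h1 := hΩ.apply_neg x u a
        have h2 : -Ω.toFun x u = 0 := hu
        rw [h2, map_zero] at h1
        rw [map_zero]
        exact h1.symm
      exact (SeparatingDual.eq_iff_forall_dual_eq (R := ℝ)
        (V := EuclideanSpace ℝ (Fin n))).2 key)
    (by
      have h := (LinearMap.toContinuousLinearMap (𝕜 := ℝ) (E := EuclideanSpace ℝ (Fin n))
        (F' := ℝ)).finrank_eq
      refine Eq.trans ?_ h
      exact (Subspace.dual_finrank_eq (K := ℝ) (V := EuclideanSpace ℝ (Fin n))).symm)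

theorem IsInverseOf.flat_apply (hΩ : Ω.IsInverseOf P) (x : M) (u : TangentSpace (𝓡 n) x) :
    hΩ.flat x u = -Ω.toFun x u := rfl

theorem IsInverseOf.poisson_apply (hΩ : Ω.IsInverseOf P) (x : M) (α β : Cotangent n x) :
    P.toFun x α β = β ((hΩ.flat x).symm α) := by
  rw [← hΩ.apply_neg, ← hΩ.flat_apply, LinearEquiv.apply_symm_apply]

/-- The fibre at `x` of the bilinear form `ω_{ja} ω_{kb} g^{ab}`. -/
def transportInner (Ω : TwoForm n M) (g : RiemMetric n M) (x : M) :
    TangentSpace (𝓡 n) x →L[ℝ] TangentSpace (𝓡 n) x →L[ℝ] ℝ :=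
  have : FiniteDimensional ℝ (Cotangent n x) :=
    inferInstanceAs (FiniteDimensional ℝ (EuclideanSpace ℝ (Fin n) →L[ℝ] ℝ));
  -- The sign compensates for feeding the raised covector into the first slot of `ω` instead of the
  -- second.
  -((Ω.toFun x).comp ((LinearMap.toContinuousLinearMap
    ((lowerEquiv g x).symm : Cotangent n x →ₗ[ℝ] TangentSpace (𝓡 n) x)).comp (Ω.toFun x)))

theorem transportInner_apply (Ω : TwoForm n M) (g : RiemMetric n M) (x : M)
    (u v : TangentSpace (𝓡 n) x) :
    Ω.transportInner g x u v = cometric g x (Ω.toFun x u) (Ω.toFun x v) :=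
  Ω.neg_swap x _ _

/-- `flat` differs from `ω(u, ·)` by a sign, which cancels in the quadratic expression. So `flat` is
an isometry from the new metric to the cometric. -/
theorem IsInverseOf.transportInner_apply (hΩ : Ω.IsInverseOf P) (g : RiemMetric n M) (x : M)
    (u v : TangentSpace (𝓡 n) x) :
    Ω.transportInner g x u v = cometric g x (hΩ.flat x u) (hΩ.flat x v) := by
  rw [Ω.transportInner_apply, hΩ.flat_apply, hΩ.flat_apply, ← neg_one_smul ℝ (Ω.toFun x u),
    ← neg_one_smul ℝ (Ω.toFun x v), cometric_smul_left, cometric_smul_right]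
  ring

theorem IsInverseOf.transportInner_pos (hΩ : Ω.IsInverseOf P) (g : RiemMetric n M) (x : M)
    (u : TangentSpace (𝓡 n) x) (hu : u ≠ 0) : 0 < Ω.transportInner g x u u := by
  rw [hΩ.transportInner_apply]
  exact cometric_self_pos g x ((hΩ.flat x).map_ne_zero_iff.2 hu)

variable [T2Space M]

theorem IsInverseOf.isSmoothSection_flat (hΩ : Ω.IsInverseOf P) {X : Π x : M, TangentSpace (𝓡 n) x}
    (hX : IsSmoothSection n (EuclideanSpace ℝ (Fin n)) X) :
    IsSmoothSection n (EuclideanSpace ℝ (Fin n) →L[ℝ] ℝ)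
      (V := fun x => TangentSpace (𝓡 n) x →L[ℝ] Trivial M ℝ x) fun x => hΩ.flat x (X x) :=
  isSmoothSection_form _ fun Y hY => (Ω.smooth X Y hX hY.1).neg

theorem IsInverseOf.flat_mem (hΩ : Ω.IsInverseOf P) {X : Π x : M, TangentSpace (𝓡 n) x}
    (hX : X ∈ testFields n M) : (fun x => hΩ.flat x (X x)) ∈ testForms n M :=
  mem_testSections_of_forall hX (hΩ.isSmoothSection_flat hX.1) fun x hx => by
    rw [hx]
    exact map_zero _

theorem IsInverseOf.sharp_mem (hΩ : Ω.IsInverseOf P)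
    {σ : Π x : M, TangentSpace (𝓡 n) x →L[ℝ] Trivial M ℝ x} (hσ : σ ∈ testForms n M) :
    (fun x => (hΩ.flat x).symm (σ x)) ∈ testFields n M :=
  mem_testSections_of_forall hσ (isSmoothSection_symm_apply hΩ.flat
    (fun _ hX => hΩ.isSmoothSection_flat hX.1) hσ.1) fun x hx => by
    rw [hx]
    exact map_zero (hΩ.flat x).symm

/-- The Riemannian metric `ω_{ja} ω_{kb} g^{ab}`. -/
def IsInverseOf.metric (hΩ : Ω.IsInverseOf P) (g : RiemMetric n M) : RiemMetric n M where
  inner := Ω.transportInner g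
  symm x u v := by rw [Ω.transportInner_apply, Ω.transportInner_apply, cometric_comm]
  pos := hΩ.transportInner_pos g
  isVonNBounded x := isVonNBounded_of_pos (E := EuclideanSpace ℝ (Fin n)) (Ω.transportInner g x)
    (hΩ.transportInner_pos g x)
  contMDiff :=
    isSmoothSection_hom (F := EuclideanSpace ℝ (Fin n)) (V := fun x : M => TangentSpace (𝓡 n) x)
      (V' := fun x : M => TangentSpace (𝓡 n) x →L[ℝ] Trivial M ℝ x) (Ω.transportInner g)
      fun _ hX => isSmoothSection_form _ fun _ hY =>
        (contMDiff_cometric g (hΩ.isSmoothSection_flat hX.1) (hΩ.isSmoothSection_flat hY.1)).congr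
          fun x => hΩ.transportInner_apply g x _ _

end TwoForm

end

/-! ### Reality of the contravariant connection on `1`-forms. -/

section

theorem eq_of_tensorial {n : ℕ} {M : Type*} [TopologicalSpace M]
    [ChartedSpace (EuclideanSpace ℝ (Fin n)) M] [T2Space M] [IsManifold (𝓡 n) ∞ M]
    {F : Type*} [NormedAddCommGroup F] [NormedSpace ℝ F] [FiniteDimensional ℝ F] {V : M → Type*}
    [TopologicalSpace (TotalSpace F V)] [∀ x, AddCommGroup (V x)] [∀ x, Module ℝ (V x)]
    [∀ x, TopologicalSpace (V x)] [FiberBundle F V] [VectorBundle ℝ F V]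
    [ContMDiffVectorBundle ∞ F V (𝓡 n)] {B : Type*} [AddCommGroup B] [Module ℝ B]
    (J : (Π x, V x) → B) (x₀ : M)
    (hadd : ∀ s ∈ testSections n F V, ∀ t ∈ testSections n F V, J (s + t) = J s + J t)
    (hsmul : ∀ f, IsRealTest n f → ∀ s ∈ testSections n F V,
      J (fun x => f x • s x) = f x₀ • J s)
    {s t : Π x, V x} (hs : s ∈ testSections n F V) (ht : t ∈ testSections n F V)
    (hst : s x₀ = t x₀) : J s = J t := by
  have hr : (fun x => (-1 : ℝ) • t x) ∈ testSections n F V :=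
    smul_mem_testSections contMDiff_const ht
  have hsr := add_mem_testSections hs hr
  have h0 := eq_zero_of_tensorial J x₀ hadd hsmul hsr (by simp [hst])
  have h1 := hadd _ hsr _ ht
  rw [h0, zero_add] at h1
  rw [← h1]
  congr 1
  funext x
  simp

section RealFunctions

variable {n : ℕ} {M : Type*} [TopologicalSpace M]
  [ChartedSpace (EuclideanSpace ℝ (Fin n)) M]

theorem IsRealTest.ofReal_mem {f : M → ℝ} (hf : IsRealTest n f) :
    (fun x => (f x : ℂ)) ∈ testFunctions n M :=
  ⟨Complex.ofRealCLM.contMDiff.comp hf.1, hf.2.comp_left Complex.ofReal_zero⟩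

theorem isRealTest_re {f : M → ℂ} (hf : f ∈ testFunctions n M) :
    IsRealTest n (fun x => (f x).re) :=
  ⟨Complex.reCLM.contMDiff.comp hf.1, hf.2.comp_left Complex.zero_re⟩

theorem dC_ofReal {f : M → ℝ} (hf : IsRealTest n f) (x : M) :
    dC n (fun x => (f x : ℂ)) x = covC (mvfderiv (𝓡 n) f x) := by
  have h := (hf.1.mdifferentiable (by simp) x)
  have h1 : MDifferentiableAt 𝓘(ℝ, ℝ) 𝓘(ℝ, ℂ) Complex.ofRealCLM (f x) :=
    Complex.ofRealCLM.differentiableAt.mdifferentiableAt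
  refine ContinuousLinearMap.ext fun v => ?_
  have h2 := congrArg (fun L => L v) (mfderiv_comp x h1 h)
  have h3 : mfderiv 𝓘(ℝ, ℝ) 𝓘(ℝ, ℂ) Complex.ofRealCLM (f x) = Complex.ofRealCLM := by
    rw [mfderiv_eq_fderiv]
    exact Complex.ofRealCLM.fderiv
  rw [h3] at h2
  exact h2

theorem dC_ofReal_eq {f : M → ℝ} (hf : IsRealTest n f) :
    dC n (fun x => (f x : ℂ)) = fun x => covC (mvfderiv (𝓡 n) f x) :=
  funext fun x => dC_ofReal hf x

@[simp] theorem covRe_covC {x : M} (α : Cotangent n x) : covRe (covC α) = α := rfl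

@[simp] theorem covIm_covC {x : M} (α : Cotangent n x) : covIm (covC α) = 0 := rfl

theorem covC_covRe {x : M} {α : CotangentC n M x} (h : covIm α = 0) : covC (covRe α) = α :=
  ContinuousLinearMap.ext fun v => Complex.ext rfl (congrArg (fun L => L v) h).symm

theorem covC_add {x : M} (α β : Cotangent n x) : covC (α + β) = covC α + covC β :=
  ContinuousLinearMap.comp_add _ _ _

theorem covC_smul {x : M} (c : ℝ) (α : Cotangent n x) : covC (c • α) = (c : ℂ) • covC α :=
  ContinuousLinearMap.ext fun v => Complex.ofReal_mul c (α v)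

variable [IsManifold (𝓡 n) ∞ M]

theorem cometricC_covC_re (g : RiemMetric n M) (x : M) (α : CotangentC n M x) (β : Cotangent n x) :
    (cometricC g x α (covC β)).re = cometric g x (covRe α) β := by
  simp [cometricC, cometric]

theorem cometricC_covC_im (g : RiemMetric n M) (x : M) (α : CotangentC n M x) (β : Cotangent n x) :
    (cometricC g x α (covC β)).im = cometric g x (covIm α) β := by
  simp [cometricC, cometric]

theorem cometricC_comm (g : RiemMetric n M) (x : M) (α β : CotangentC n M x) :
    cometricC g x α β = cometricC g x β α := by
  simp only [cometricC, cometric_comm g x (covRe α), cometric_comm g x (covIm α)]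
  congr 1
  ring

theorem cometricC_covC_covC (g : RiemMetric n M) (x : M) (α β : Cotangent n x) :
    cometricC g x (covC α) (covC β) = (cometric g x α β : ℝ) := by
  apply Complex.ext
  · rw [cometricC_covC_re, covRe_covC, Complex.ofReal_re]
  · rw [cometricC_covC_im, covIm_covC, Complex.ofReal_im]
    simp [cometric]

variable (P : BivectorField n M)

/-- The Poisson bracket of real functions. -/
def BivectorField.realBracket (f h : M → ℝ) (x : M) : ℝ :=
  P.toFun x (mvfderiv (𝓡 n) f x) (mvfderiv (𝓡 n) h x)

theorem BivectorField.bracket_ofReal {f h : M → ℝ} (hf : IsRealTest n f) (hh : IsRealTest n h) :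
    P.bracket (fun x => (f x : ℂ)) (fun x => (h x : ℂ)) = fun x => (P.realBracket f h x : ℂ) := by
  funext x
  rw [bracket, dC_ofReal hf, dC_ofReal hh]
  apply Complex.ext <;> simp [complexify, realBracket]

end RealFunctions

namespace DeformedSpectralTriple

variable {n : ℕ} {M : Type*} [TopologicalSpace M]
  [ChartedSpace (EuclideanSpace ℝ (Fin n)) M] [IsManifold (𝓡 n) ∞ M] {g : RiemMetric n M}
  {F : Type*} [NormedAddCommGroup F] [NormedSpace ℂ F]
  {V : M → Type*} [TopologicalSpace (TotalSpace F V)] [∀ x, TopologicalSpace (V x)]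
  [∀ x, AddCommGroup (V x)] [∀ x, Module ℂ (V x)] [FiberBundle F V]
  {K A W : Type*} [CommRing K] [Algebra ℂ K]
  [NonUnitalRing A] [Module K A] [IsScalarTower K A A] [SMulCommClass K A A]
  [AddCommGroup W] [Module K W]
  (T : DeformedSpectralTriple g F V K A W) {P : BivectorField n M}

theorem isRealTest_realBracket (T : DeformedSpectralTriple g F V K A W)
    (hP : T.deformation.IsPoissonField P) {f h : M → ℝ} (hf : IsRealTest n f)
    (hh : IsRealTest n h) : IsRealTest n (P.realBracket f h) := by
  have := isRealTest_re (hP.bracket_mem hf.ofReal_mem hh.ofReal_mem)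
  rw [P.bracket_ofReal hf hh] at this
  exact this

/-- The contravariant connection on real `1`-forms, with values in complex `1`-forms. -/
def connR (f : M → ℝ) (σ : Π x : M, TangentSpace (𝓡 n) x →L[ℝ] Trivial M ℝ x) :
    Π x, CotangentC n M x :=
  T.oneForms.conn (fun x => (f x : ℂ)) (fun x => covC (σ x))

variable {f h k : M → ℝ} {σ τ : Π x : M, TangentSpace (𝓡 n) x →L[ℝ] Trivial M ℝ x}

theorem connR_mvfderiv_sub (hP : T.deformation.IsPoissonField P) {f h : M → ℝ}
    (hf : IsRealTest n f) (hh : IsRealTest n h) :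
    T.connR f (fun x => mvfderiv (𝓡 n) h x) - T.connR h (fun x => mvfderiv (𝓡 n) f x) =
      fun x => covC (mvfderiv (𝓡 n) (P.realBracket f h) x) := by
  have := T.conn_dC_sub hP hf.ofReal_mem hh.ofReal_mem
  rwa [P.bracket_ofReal hf hh, dC_ofReal_eq hf, dC_ofReal_eq hh,
    dC_ofReal_eq (T.isRealTest_realBracket hP hf hh)] at this

variable [T2Space M]

theorem mvfderiv_mem (T : DeformedSpectralTriple g F V K A W) {f : M → ℝ} (hf : IsRealTest n f) :
    (fun x => mvfderiv (𝓡 n) f x) ∈ testForms n M := by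
  have h := covRe_mem (T.dC_mem hf.ofReal_mem)
  simp only [dC_ofReal hf] at h
  exact h

theorem connR_mem (hf : IsRealTest n f) (hσ : σ ∈ testForms n M) : T.connR f σ ∈ testFormsC n M :=
  T.oneForms.conn_mem _ _ hf.ofReal_mem (covC_mem hσ)

theorem connR_add (hf : IsRealTest n f) (hσ : σ ∈ testForms n M) (hτ : τ ∈ testForms n M) :
    T.connR f (σ + τ) = T.connR f σ + T.connR f τ := by
  rw [connR, connR, connR, ← T.oneForms.conn_add hf.ofReal_mem (covC_mem hσ) (covC_mem hτ)]
  congr 1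
  exact funext fun x => covC_add _ _

theorem connR_add_left (hf : IsRealTest n f) (hh : IsRealTest n h) (hσ : σ ∈ testForms n M) :
    T.connR (f + h) σ = T.connR f σ + T.connR h σ := by
  rw [connR, connR, connR, ← T.oneForms.conn_add_left hf.ofReal_mem hh.ofReal_mem (covC_mem hσ)]
  congr 1
  exact funext fun x => Complex.ofReal_add _ _

theorem connR_smul_left (c : ℝ) (hf : IsRealTest n f) (hσ : σ ∈ testForms n M) :
    T.connR (c • f) σ = (c : ℂ) • T.connR f σ := by
  rw [connR, connR, ← T.oneForms.conn_smul_left _ hf.ofReal_mem (covC_mem hσ)]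
  congr 1
  exact funext fun x => Complex.ofReal_mul _ _

theorem connR_leibniz (hP : T.deformation.IsPoissonField P) (hf : IsRealTest n f)
    (hh : IsRealTest n h) (hσ : σ ∈ testForms n M) (x : M) :
    T.connR f (fun x => h x • σ x) x =
      (P.realBracket f h x : ℂ) • covC (σ x) + (h x : ℂ) • T.connR f σ x := by
  have := T.oneForms.conn_leibniz hP hf.ofReal_mem hh.ofReal_mem (covC_mem hσ)
  rw [P.bracket_ofReal hf hh] at this
  refine Eq.trans ?_ (congrFun this x)
  rw [connR]
  congr 1
  exact funext fun x => covC_smul _ _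

theorem exists_testFunction_eq_one (x : M) : ∃ f ∈ testFunctions n M, f x = 1 := by
  obtain ⟨ψ, hψ, hψ1, -⟩ := exists_isRealTest_bump (n := n) (Filter.univ_mem : Set.univ ∈ 𝓝 x)
  exact ⟨_, hψ.ofReal_mem, by simp [hψ1.self_of_nhds]⟩

theorem isRealTest_cometric (hσ : σ ∈ testForms n M) (hτ : τ ∈ testForms n M) :
    IsRealTest n (fun x => cometric g x (σ x) (τ x)) := by
  have := isRealTest_re (cometricC_mem g (covC_mem hσ) (covC_mem hτ))
  simpa only [cometricC_covC_covC, Complex.ofReal_re] using this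

theorem realBracket_cometric (hV : ∀ x : M, ∃ s ∈ testSections n F V, s x ≠ 0)
    (hP : T.deformation.IsPoissonField P) (hf : IsRealTest n f) (hσ : σ ∈ testForms n M)
    (hτ : τ ∈ testForms n M) (x : M) :
    (P.realBracket f (fun x => cometric g x (σ x) (τ x)) x : ℂ) =
      cometricC g x (T.connR f σ x) (covC (τ x)) + cometricC g x (T.connR f τ x) (covC (σ x)) := by
  have := T.bracket_cometricC exists_testFunction_eq_one hV hP hf.ofReal_mem (covC_mem hσ)
    (covC_mem hτ) (cometricC_mem g (covC_mem hσ) (covC_mem hτ)) x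
  simp only [cometricC_covC_covC] at this
  rw [P.bracket_ofReal hf (isRealTest_cometric hσ hτ)] at this
  refine this.trans ?_
  rw [cometricC_comm g x (covC (σ x))]
  rfl

/-- The imaginary part of metric compatibility: the bracket of real functions is real, so the
imaginary part of the connection is skew for the metric. -/
theorem cometric_covIm_connR_add (hV : ∀ x : M, ∃ s ∈ testSections n F V, s x ≠ 0)
    (hP : T.deformation.IsPoissonField P) (hf : IsRealTest n f) (hσ : σ ∈ testForms n M)
    (hτ : τ ∈ testForms n M) (x : M) :
    cometric g x (covIm (T.connR f σ x)) (τ x) +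
      cometric g x (covIm (T.connR f τ x)) (σ x) = 0 := by
  have := congrArg Complex.im (T.realBracket_cometric hV hP hf hσ hτ x)
  rw [Complex.ofReal_im, Complex.add_im, cometricC_covC_im, cometricC_covC_im] at this
  exact this.symm

/-- The argument for uniqueness of the Levi-Civita connection. Pairing the imaginary part with `dk`
gives an expression in three functions, symmetric in the first two and skew in the last two, and the
six permutations force it to vanish. -/
theorem covIm_connR_mvfderiv (hV : ∀ x : M, ∃ s ∈ testSections n F V, s x ≠ 0)
    (hP : T.deformation.IsPoissonField P) (hf : IsRealTest n f) (hh : IsRealTest n h) (x : M) :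
    covIm (T.connR f (fun x => mvfderiv (𝓡 n) h x) x) = 0 := by
  let S : (M → ℝ) → (M → ℝ) → (M → ℝ) → ℝ := fun f h k =>
    cometric g x (covIm (T.connR f (fun x => mvfderiv (𝓡 n) h x) x)) (mvfderiv (𝓡 n) k x)
  have hskew : ∀ f h k, IsRealTest n f → IsRealTest n h → IsRealTest n k →
      S f h k = - S f k h := fun f h k hf hh hk =>
    eq_neg_of_add_eq_zero_left
      (T.cometric_covIm_connR_add hV hP hf (T.mvfderiv_mem hh) (T.mvfderiv_mem hk) x)
  have hsymm : ∀ f h k, IsRealTest n f → IsRealTest n h → S f h k = S h f k := by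
    intro f h k hf hh
    have h1 := congrArg covIm (congrFun (T.connR_mvfderiv_sub hP hf hh) x)
    rw [covIm_covC, Pi.sub_apply] at h1
    have h2 : covIm (T.connR f (fun x => mvfderiv (𝓡 n) h x) x) -
        covIm (T.connR h (fun x => mvfderiv (𝓡 n) f x) x) = 0 := by
      rw [← h1]
      exact (ContinuousLinearMap.comp_sub _ _ _).symm
    simp only [S, sub_eq_zero.1 h2]
  have hzero : ∀ k, IsRealTest n k → S f h k = 0 := fun k hk => by
    have h1 := hskew f h k hf hh hk
    have h2 := hsymm f k h hf hk
    have h3 := hskew k f h hk hf hh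
    have h4 := hsymm k h f hk hh
    have h5 := hskew h k f hh hk hf
    have h6 := hsymm h f k hh hf
    linarith
  by_contra hne
  -- Testing against a `k` whose differential at `x` is the imaginary part itself contradicts
  -- positivity of the cometric.
  obtain ⟨k, hk, hkx⟩ := exists_isRealTest_mvfderiv_eq x
    (covIm (T.connR f (fun x => mvfderiv (𝓡 n) h x) x))
  have h1 := hzero k hk
  have h2 := cometric_self_pos g x hne
  simp only [S, hkx] at h1
  exact h2.ne' h1

/-- The contravariant connection on `1`-forms is real. -/
theorem covIm_connR (hV : ∀ x : M, ∃ s ∈ testSections n F V, s x ≠ 0)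
    (hP : T.deformation.IsPoissonField P) (hf : IsRealTest n f) (hσ : σ ∈ testForms n M) (x : M) :
    covIm (T.connR f σ x) = 0 := by
  obtain ⟨h, hh, hhx⟩ := exists_isRealTest_mvfderiv_eq x (σ x)
  -- The derivative term of the Leibniz rule is real, so the imaginary part is tensorial in `σ`,
  -- which may then be replaced by an exact form with the same value at `x`.
  refine (eq_of_tensorial (n := n) (F := EuclideanSpace ℝ (Fin n) →L[ℝ] ℝ)
    (V := fun x : M => TangentSpace (𝓡 n) x →L[ℝ] Trivial M ℝ x)
    (fun σ => covIm (T.connR f σ x)) x ?_ ?_ hσ (T.mvfderiv_mem hh) hhx.symm).trans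
    (T.covIm_connR_mvfderiv hV hP hf hh x)
  · intro s hs t ht
    rw [T.connR_add hf hs ht, Pi.add_apply, covIm_add]
  · intro k hk s hs
    rw [T.connR_leibniz hP hf hk hs, covIm_add, covIm_smul, covIm_smul]
    simp

end DeformedSpectralTriple

end

/-! ### Transport to vector fields: a flat connection along Hamiltonian fields. -/

section

/-- A flat torsion-free metric connection along Hamiltonian vector fields: `H f` is the Hamiltonian
field of `f` and `N f Y` the derivative of the field `Y` along it. -/
structure IsFlatHamiltonianConnection {n : ℕ} {M : Type*} [TopologicalSpace M]
    [ChartedSpace (EuclideanSpace ℝ (Fin n)) M] [IsManifold (𝓡 n) ∞ M] (g : RiemMetric n M)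
    (H : (M → ℝ) → Π x : M, TangentSpace (𝓡 n) x) (br : (M → ℝ) → (M → ℝ) → M → ℝ)
    (N : (M → ℝ) → (Π x : M, TangentSpace (𝓡 n) x) → Π x : M, TangentSpace (𝓡 n) x) : Prop where
  H_mem : ∀ {f}, IsRealTest n f → H f ∈ testFields n M
  exists_H_eq : ∀ (x : M) (v : TangentSpace (𝓡 n) x), ∃ f, IsRealTest n f ∧ H f x = v
  br_mem : ∀ {f h}, IsRealTest n f → IsRealTest n h → IsRealTest n (br f h)
  H_add : ∀ {f h}, IsRealTest n f → IsRealTest n h → ∀ x, H (f + h) x = H f x + H h x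
  H_smul : ∀ (c : ℝ) {f}, IsRealTest n f → ∀ x, H (c • f) x = c • H f x
  H_br : ∀ {f h}, IsRealTest n f → IsRealTest n h → ∀ x,
    H (br f h) x = VectorField.mlieBracket (𝓡 n) (H f) (H h) x
  N_mem : ∀ {f Y}, IsRealTest n f → Y ∈ testFields n M → N f Y ∈ testFields n M
  N_add : ∀ {f Y Z}, IsRealTest n f → Y ∈ testFields n M → Z ∈ testFields n M →
    N f (Y + Z) = N f Y + N f Z
  N_add_left : ∀ {f h Y}, IsRealTest n f → IsRealTest n h → Y ∈ testFields n M →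
    N (f + h) Y = N f Y + N h Y
  N_smul_left : ∀ (c : ℝ) {f Y}, IsRealTest n f → Y ∈ testFields n M → N (c • f) Y = c • N f Y
  N_leibniz : ∀ {f h Y}, IsRealTest n f → IsRealTest n h → Y ∈ testFields n M → ∀ x,
    N f (fun x => h x • Y x) x = mvfderiv (𝓡 n) h x (H f x) • Y x + h x • N f Y x
  torsion : ∀ {f h}, IsRealTest n f → IsRealTest n h → N f (H h) - N h (H f) = H (br f h)
  flat : ∀ {f h Y}, IsRealTest n f → IsRealTest n h → Y ∈ testFields n M →
    N f (N h Y) - N h (N f Y) = N (br f h) Y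
  metric : ∀ {f Y Z}, IsRealTest n f → Y ∈ testFields n M → Z ∈ testFields n M → ∀ x,
    mvfderiv (𝓡 n) (fun y => g.inner y (Y y) (Z y)) x (H f x) =
      g.inner x (N f Y x) (Z x) + g.inner x (Y x) (N f Z x)

section

variable {n : ℕ} {M : Type*} [TopologicalSpace M]
  [ChartedSpace (EuclideanSpace ℝ (Fin n)) M]

theorem mvfderiv_add' {f h : M → ℝ} (hf : IsRealTest n f) (hh : IsRealTest n h) (x : M) :
    mvfderiv (𝓡 n) (f + h) x = mvfderiv (𝓡 n) f x + mvfderiv (𝓡 n) h x :=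
  mvfderiv_add (hf.1.mdifferentiable (by simp) x) (hh.1.mdifferentiable (by simp) x)

theorem mvfderiv_const_smul' (c : ℝ) {f : M → ℝ} (hf : IsRealTest n f) (x : M) :
    mvfderiv (𝓡 n) (c • f) x = c • mvfderiv (𝓡 n) f x := by
  have h := mvfderiv_smul (I := 𝓡 n) (a := fun _ => c) mdifferentiableAt_const
    (hf.1.mdifferentiable (by simp) x)
  have h0 : mvfderiv (𝓡 n) (fun _ : M => c) x = 0 := by
    simp [mvfderiv]
  rw [h0] at h
  refine h.trans ?_
  ext v
  simp

end

namespace DeformedSpectralTriple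

variable {n : ℕ} {M : Type*} [TopologicalSpace M]
  [ChartedSpace (EuclideanSpace ℝ (Fin n)) M] [IsManifold (𝓡 n) ∞ M] {g : RiemMetric n M}
  {F : Type*} [NormedAddCommGroup F] [NormedSpace ℂ F]
  {V : M → Type*} [TopologicalSpace (TotalSpace F V)] [∀ x, TopologicalSpace (V x)]
  [∀ x, AddCommGroup (V x)] [∀ x, Module ℂ (V x)] [FiberBundle F V]
  {K A W : Type*} [CommRing K] [Algebra ℂ K]
  [NonUnitalRing A] [Module K A] [IsScalarTower K A A] [SMulCommClass K A A]
  [AddCommGroup W] [Module K W]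
  (T : DeformedSpectralTriple g F V K A W) {P : BivectorField n M} {Ω : TwoForm n M}

/-- The Hamiltonian vector field of a function. -/
def _root_.TwoForm.IsInverseOf.hamiltonian (hΩ : Ω.IsInverseOf P) (f : M → ℝ) (x : M) :
    TangentSpace (𝓡 n) x :=
  (hΩ.flat x).symm (mvfderiv (𝓡 n) f x)

/-- The derivative of a vector field along a Hamiltonian vector field, for the contravariant
connection of a deformed spectral triple. -/
def connField (hΩ : Ω.IsInverseOf P) (f : M → ℝ) (Y : Π x : M, TangentSpace (𝓡 n) x) (x : M) :
    TangentSpace (𝓡 n) x :=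
  (hΩ.flat x).symm (covRe (T.connR f (fun x => hΩ.flat x (Y x)) x))

theorem _root_.TwoForm.IsInverseOf.mvfderiv_hamiltonian (hΩ : Ω.IsInverseOf P) (f h : M → ℝ)
    (x : M) : mvfderiv (𝓡 n) h x (hΩ.hamiltonian f x) = P.realBracket f h x :=
  (hΩ.poisson_apply x _ _).symm

theorem realBracket_jacobi (T : DeformedSpectralTriple g F V K A W)
    (hP : T.deformation.IsPoissonField P) {f h k : M → ℝ} (hf : IsRealTest n f)
    (hh : IsRealTest n h) (hk : IsRealTest n k) (x : M) :
    P.realBracket f (P.realBracket h k) x - P.realBracket h (P.realBracket f k) x =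
      P.realBracket (P.realBracket f h) k x := by
  have hfh := T.isRealTest_realBracket hP hf hh
  have hfk := T.isRealTest_realBracket hP hf hk
  have hhk := T.isRealTest_realBracket hP hh hk
  have := congrFun (hP.jacobi hf.ofReal_mem hh.ofReal_mem hk.ofReal_mem) x
  rw [P.bracket_ofReal hh hk, P.bracket_ofReal hf hk, P.bracket_ofReal hf hh,
    P.bracket_ofReal hf hhk, P.bracket_ofReal hh hfk, P.bracket_ofReal hfh hk] at this
  exact Complex.ofReal_injective (by rw [Complex.ofReal_sub]; exact this)

variable [T2Space M]

theorem hamiltonian_mem (T : DeformedSpectralTriple g F V K A W) (hΩ : Ω.IsInverseOf P) {f : M → ℝ}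
    (hf : IsRealTest n f) : hΩ.hamiltonian f ∈ testFields n M :=
  hΩ.sharp_mem (T.mvfderiv_mem hf)

/-- By reality, the real part taken in `connField` loses nothing; this is needed to iterate the
connection. -/
theorem connField_flat (hV : ∀ x : M, ∃ s ∈ testSections n F V, s x ≠ 0)
    (hP : T.deformation.IsPoissonField P) (hΩ : Ω.IsInverseOf P) {f : M → ℝ}
    {Y : Π x : M, TangentSpace (𝓡 n) x} (hf : IsRealTest n f) (hY : Y ∈ testFields n M) (x : M) :
    covC (hΩ.flat x (T.connField hΩ f Y x)) = T.connR f (fun x => hΩ.flat x (Y x)) x := by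
  rw [connField, LinearEquiv.apply_symm_apply,
    covC_covRe (T.covIm_connR hV hP hf (hΩ.flat_mem hY) x)]

/-- The contravariant connection of a deformed spectral triple, transported to vector fields by a
symplectic form, is flat, metric and torsion free. -/
theorem isFlatHamiltonianConnection (hV : ∀ x : M, ∃ s ∈ testSections n F V, s x ≠ 0)
    (hP : T.deformation.IsPoissonField P) (hΩ : Ω.IsInverseOf P) :
    IsFlatHamiltonianConnection (hΩ.metric g) hΩ.hamiltonian P.realBracket (T.connField hΩ) where
  H_mem := T.hamiltonian_mem hΩ
  exists_H_eq x v := by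
    obtain ⟨f, hf, hfx⟩ := exists_isRealTest_mvfderiv_eq x (hΩ.flat x v)
    refine ⟨f, hf, ?_⟩
    rw [TwoForm.IsInverseOf.hamiltonian, hfx]
    exact (hΩ.flat x).symm_apply_apply v
  br_mem := T.isRealTest_realBracket hP
  H_add hf hh x := by
    simp only [TwoForm.IsInverseOf.hamiltonian]
    rw [mvfderiv_add' hf hh]
    exact map_add (hΩ.flat x).symm _ _
  H_smul c f hf x := by
    simp only [TwoForm.IsInverseOf.hamiltonian]
    rw [mvfderiv_const_smul' c hf]
    exact map_smul (hΩ.flat x).symm _ _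
  H_br {f h} hf hh x := by
    -- Tested on functions, the claim that `f ↦ H f` is a Lie homomorphism is the Jacobi identity of
    -- the bracket.
    refine eq_of_forall_mvfderiv_eq fun k hk => ?_
    have hfk := T.isRealTest_realBracket hP hf hk
    have hhk := T.isRealTest_realBracket hP hh hk
    have e1 : (fun y => mvfderiv (𝓡 n) k y (hΩ.hamiltonian f y)) = P.realBracket f k :=
      funext fun y => hΩ.mvfderiv_hamiltonian f k y
    have e2 : (fun y => mvfderiv (𝓡 n) k y (hΩ.hamiltonian h y)) = P.realBracket h k :=
      funext fun y => hΩ.mvfderiv_hamiltonian h k y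
    rw [mvfderiv_mlieBracket (T.hamiltonian_mem hΩ hf).1 (T.hamiltonian_mem hΩ hh).1 hk.1
      (by rw [e1]; exact hfk.1)
      (by rw [e2]; exact hhk.1), e1, e2, hΩ.mvfderiv_hamiltonian, hΩ.mvfderiv_hamiltonian,
      hΩ.mvfderiv_hamiltonian, T.realBracket_jacobi hP hf hh hk]
  N_mem hf hY := hΩ.sharp_mem (covRe_mem (T.connR_mem hf (hΩ.flat_mem hY)))
  N_add {f Y Z} hf hY hZ := by
    funext x
    simp only [connField, Pi.add_apply, map_add]
    have h1 := congrFun (T.connR_add hf (hΩ.flat_mem hY) (hΩ.flat_mem hZ)) x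
    have h2 : T.connR f (fun x => hΩ.flat x (Y x) + hΩ.flat x (Z x)) x =
      T.connR f (fun x => hΩ.flat x (Y x)) x + T.connR f (fun x => hΩ.flat x (Z x)) x := h1
    rw [h2, covRe_add]
    exact map_add (hΩ.flat x).symm _ _
  N_add_left {f h Y} hf hh hY := by
    funext x
    simp only [connField, Pi.add_apply]
    rw [T.connR_add_left hf hh (hΩ.flat_mem hY), Pi.add_apply, covRe_add]
    exact map_add (hΩ.flat x).symm _ _
  N_smul_left c f Y hf hY := by
    funext x
    simp only [connField, Pi.smul_apply]
    rw [T.connR_smul_left c hf (hΩ.flat_mem hY), Pi.smul_apply, covRe_smul, Complex.ofReal_re,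
      Complex.ofReal_im, zero_smul, sub_zero]
    exact map_smul (hΩ.flat x).symm _ _
  N_leibniz {f h Y} hf hh hY x := by
    simp only [connField, map_smul]
    have h1 := T.connR_leibniz hP hf hh (hΩ.flat_mem hY) x
    have h2 : ∀ (c : ℝ) (α : CotangentC n M x), covRe ((c : ℂ) • α) = c • covRe α := fun c α => by
      rw [covRe_smul, Complex.ofReal_re, Complex.ofReal_im, zero_smul, sub_zero]
    rw [h1, covRe_add, h2, h2, covRe_covC, hΩ.mvfderiv_hamiltonian]
    refine (map_add (hΩ.flat x).symm _ _).trans ?_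
    congr 1
    · refine (map_smul (hΩ.flat x).symm _ _).trans ?_
      rw [(hΩ.flat x).symm_apply_apply]
    · exact map_smul (hΩ.flat x).symm _ _
  torsion {f h} hf hh := by
    funext x
    -- Hamiltonian fields correspond to exact forms, for which the torsion identity is known.
    have e : ∀ k, (fun x => hΩ.flat x (hΩ.hamiltonian k x)) = fun x => mvfderiv (𝓡 n) k x :=
      fun k => funext fun x => (hΩ.flat x).apply_symm_apply _
    have h1 := congrArg covRe (congrFun (T.connR_mvfderiv_sub hP hf hh) x)
    rw [Pi.sub_apply, covRe_covC] at h1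
    rw [Pi.sub_apply, connField, connField, e, e, TwoForm.IsInverseOf.hamiltonian, ← h1]
    exact (map_sub (hΩ.flat x).symm _ _).symm
  flat {f h Y} hf hh hY := by
    funext x
    have h1 := congrFun (T.oneForms.conn_conn_sub hP hf.ofReal_mem hh.ofReal_mem
      (covC_mem (hΩ.flat_mem hY))) x
    have e : ∀ k, IsRealTest n k → T.oneForms.conn (fun x => (k x : ℂ))
        (fun x => covC (hΩ.flat x (Y x))) =
        fun x => covC (hΩ.flat x (T.connField hΩ k Y x)) := fun k hk =>
      funext fun x => (T.connField_flat hV hP hΩ hk hY x).symm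
    rw [P.bracket_ofReal hf hh, Pi.sub_apply, e f hf, e h hh] at h1
    have h2 := congrArg covRe h1
    change covRe (T.connR f (fun x => hΩ.flat x (T.connField hΩ h Y x)) x) -
      covRe (T.connR h (fun x => hΩ.flat x (T.connField hΩ f Y x)) x) =
      covRe (T.connR (P.realBracket f h) (fun x => hΩ.flat x (Y x)) x) at h2
    refine Eq.trans ?_ (congrArg (hΩ.flat x).symm h2)
    exact (map_sub (hΩ.flat x).symm _ _).symm
  metric {f Y Z} hf hY hZ x := by
    have h1 := T.realBracket_cometric hV hP hf (hΩ.flat_mem hY) (hΩ.flat_mem hZ) x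
    have h2 := congrArg Complex.re h1
    rw [Complex.ofReal_re, Complex.add_re, cometricC_covC_re, cometricC_covC_re] at h2
    have e : (fun y => (hΩ.metric g).inner y (Y y) (Z y)) =
        fun y => cometric g y (hΩ.flat y (Y y)) (hΩ.flat y (Z y)) :=
      funext fun y => hΩ.transportInner_apply g y _ _
    have e' : ∀ u v : TangentSpace (𝓡 n) x, (hΩ.metric g).inner x u v =
        cometric g x (hΩ.flat x u) (hΩ.flat x v) := hΩ.transportInner_apply g x
    rw [hΩ.mvfderiv_hamiltonian, e, h2, e', e', connField, connField,
      LinearEquiv.apply_symm_apply, LinearEquiv.apply_symm_apply,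
      cometric_comm g x (hΩ.flat x (Y x))]

end DeformedSpectralTriple

end

/-! ### Extension from Hamiltonian fields to an ordinary covariant derivative. -/

section

namespace IsFlatHamiltonianConnection

variable {n : ℕ} {M : Type*} [TopologicalSpace M]
  [ChartedSpace (EuclideanSpace ℝ (Fin n)) M] [IsManifold (𝓡 n) ∞ M] {g : RiemMetric n M}
  {H : (M → ℝ) → Π x : M, TangentSpace (𝓡 n) x} {br : (M → ℝ) → (M → ℝ) → M → ℝ}
  {N : (M → ℝ) → (Π x : M, TangentSpace (𝓡 n) x) → Π x : M, TangentSpace (𝓡 n) x}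

theorem N_sum (h : IsFlatHamiltonianConnection g H br N) {f : M → ℝ} (hf : IsRealTest n f)
    {ι : Type*} (S : Finset ι) (Y : ι → Π x : M, TangentSpace (𝓡 n) x)
    (hY : ∀ i, Y i ∈ testFields n M) : N f (∑ i ∈ S, Y i) = ∑ i ∈ S, N f (Y i) := by
  classical
  induction S using Finset.induction_on with
  | empty =>
    have h0 := h.N_add hf (zero_mem_testSections (n := n) (F := EuclideanSpace ℝ (Fin n))
      (V := fun x : M => TangentSpace (𝓡 n) x)) zero_mem_testSections
    simpa using h0
  | insert i S hi ih =>
    rw [Finset.sum_insert hi, Finset.sum_insert hi, ← ih,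
      h.N_add hf (hY i) (sum_mem_testSections _ _ fun j _ => hY j)]

variable [T2Space M]

/-- Vanishing torsion rewrites `N f (H k)` as `N k X + [X, H k]` with `X = H f`. The derivatives of
a coefficient of `X` cancel between the two terms, so the expression is tensorial in `X` and
vanishes where `X` does. -/
theorem N_H_eq_zero (h : IsFlatHamiltonianConnection g H br N) {f k : M → ℝ}
    (hf : IsRealTest n f) (hk : IsRealTest n k) {x : M} (hfx : H f x = 0) : N f (H k) x = 0 := by
  have hmd : ∀ {X : Π x : M, TangentSpace (𝓡 n) x}, X ∈ testFields n M →
      MDifferentiableAt (𝓡 n) (𝓡 n).tangent (fun x => (X x : TangentBundle (𝓡 n) M)) x :=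
    fun hX => hX.1.mdifferentiable (by simp) x
  have key := eq_zero_of_tensorial (n := n) (F := EuclideanSpace ℝ (Fin n))
    (V := fun x : M => TangentSpace (𝓡 n) x)
    (fun X => N k X x + VectorField.mlieBracket (𝓡 n) X (H k) x) x
    (fun X hX Y hY => by
      rw [h.N_add hk hX hY, VectorField.mlieBracket_add_left (hmd hX) (hmd hY), Pi.add_apply]
      abel)
    (fun a ha X hX => by
      have h1 := VectorField.mlieBracket_smul_left (W := H k)
        (ha.1.mdifferentiable (by simp) x) (hmd hX)
      have h2 := h.N_leibniz hk ha hX x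
      refine (congrArg₂ (· + ·) h2 h1).trans ?_
      module)
    (h.H_mem hf) hfx
  have h1 := congrFun (h.torsion hf hk) x
  rw [h.H_br hf hk, Pi.sub_apply, sub_eq_iff_eq_add'] at h1
  rw [h1, key]

/-- Where `H f` vanishes, `N f` has no derivative term and is tensorial in `Y`, so `Y` may be
replaced by a Hamiltonian field with the same value. -/
theorem N_eq_zero (h : IsFlatHamiltonianConnection g H br N) {f : M → ℝ}
    {Y : Π x : M, TangentSpace (𝓡 n) x} (hf : IsRealTest n f) (hY : Y ∈ testFields n M) {x : M}
    (hfx : H f x = 0) : N f Y x = 0 := by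
  obtain ⟨k, hk, hkx⟩ := h.exists_H_eq x (Y x)
  refine (eq_of_tensorial (n := n) (F := EuclideanSpace ℝ (Fin n))
    (V := fun x : M => TangentSpace (𝓡 n) x) (fun Y => N f Y x) x
    (fun X hX Y hY => ?_) (fun a ha X hX => ?_) hY (h.H_mem hk) hkx.symm).trans
    (h.N_H_eq_zero hf hk hfx)
  · rw [h.N_add hf hX hY, Pi.add_apply]
  · rw [h.N_leibniz hf ha hX, hfx, map_zero, zero_smul, zero_add]

theorem N_congr (h : IsFlatHamiltonianConnection g H br N) {f k : M → ℝ}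
    {Y : Π x : M, TangentSpace (𝓡 n) x} (hf : IsRealTest n f) (hk : IsRealTest n k)
    (hY : Y ∈ testFields n M) {x : M} (hfk : H f x = H k x) : N f Y x = N k Y x := by
  have hk' := hk.const_smul (-1)
  have h1 := h.N_eq_zero (hf.add hk') hY (x := x) (by
    rw [h.H_add hf hk', h.H_smul _ hk, hfk]
    module)
  rw [h.N_add_left hf hk' hY, h.N_smul_left _ hk hY] at h1
  refine sub_eq_zero.1 (Eq.trans ?_ h1)
  simp only [Pi.add_apply, Pi.smul_apply]
  module

/-- Since `N f Y x` depends on `f` only through `H f x`, any choice of Hamiltonians realising the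
tangent vectors gives the same linear map. -/
theorem exists_clm (h : IsFlatHamiltonianConnection g H br N)
    {Y : Π x : M, TangentSpace (𝓡 n) x} (hY : Y ∈ testFields n M) (x : M) :
    ∃ L : TangentSpace (𝓡 n) x →L[ℝ] TangentSpace (𝓡 n) x,
      ∀ f, IsRealTest n f → L (H f x) = N f Y x := by
  have : FiniteDimensional ℝ (TangentSpace (𝓡 n) x) :=
    inferInstanceAs (FiniteDimensional ℝ (EuclideanSpace ℝ (Fin n)))
  have : T2Space (TangentSpace (𝓡 n) x) :=
    inferInstanceAs (T2Space (EuclideanSpace ℝ (Fin n)))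
  choose F hF hFx using h.exists_H_eq x
  let L : TangentSpace (𝓡 n) x →ₗ[ℝ] TangentSpace (𝓡 n) x :=
    { toFun := fun v => N (F v) Y x
      map_add' := fun u v => by
        rw [← Pi.add_apply, ← h.N_add_left (hF u) (hF v) hY]
        exact h.N_congr (hF _) ((hF u).add (hF v)) hY (by
          rw [h.H_add (hF u) (hF v), hFx, hFx, hFx])
      map_smul' := fun c v => by
        rw [RingHom.id_apply, ← Pi.smul_apply, ← h.N_smul_left c (hF v) hY]
        exact h.N_congr (hF _) ((hF v).const_smul c) hY (by
          rw [h.H_smul c (hF v), hFx, hFx]) }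
  exact ⟨LinearMap.toContinuousLinearMap L, fun f hf => h.N_congr (hF _) hf hY (hFx _)⟩

/-- The covariant derivative which extends a derivative along Hamiltonian vector fields. -/
theorem exists_covariantDerivative (h : IsFlatHamiltonianConnection g H br N) :
    ∃ cov : CovariantDerivative (𝓡 n) (EuclideanSpace ℝ (Fin n))
      (fun x : M => TangentSpace (𝓡 n) x), ∀ f, IsRealTest n f → ∀ Y ∈ testFields n M, ∀ x,
        cov Y x (H f x) = N f Y x := by
  have : ContMDiffVectorBundle 1 (EuclideanSpace ℝ (Fin n))
    (fun x : M => TangentSpace (𝓡 n) x) (𝓡 n) := ContMDiffVectorBundle.of_le (n := ∞) (by simp)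
  let e := fun x₀ : M => trivializationAt (EuclideanSpace ℝ (Fin n))
    (fun x : M => TangentSpace (𝓡 n) x) x₀
  have he : ∀ x₀, x₀ ∈ (e x₀).baseSet := fun x₀ => FiberBundle.mem_baseSet_trivializationAt' x₀
  choose ψ hψ hψ1 hψe using fun x₀ : M =>
    exists_isRealTest_bump (n := n) ((e x₀).open_baseSet.mem_nhds (he x₀))
  let b := Module.finBasis ℝ (EuclideanSpace ℝ (Fin n))
  have hfr := fun x₀ i => cutoff_localFrame_mem_testSections (n := n) b (e x₀) (hψ x₀) (hψe x₀) i
  choose Γ hΓ using fun x₀ i => h.exists_clm (hfr x₀ i) x₀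
  let c := fun (x₀ : M) i (Y : Π x : M, TangentSpace (𝓡 n) x) (x : M) =>
    (e x₀).localFrameCoeff (𝓡 n) b i x (Y x)
  have hc : ∀ {x₀ : M} {Y : Π x : M, TangentSpace (𝓡 n) x},
      MDifferentiableAt (𝓡 n) (𝓡 n).tangent (fun x => (Y x : TangentBundle (𝓡 n) M)) x₀ →
      ∀ i, MDifferentiableAt (𝓡 n) 𝓘(ℝ, ℝ) (c x₀ i Y) x₀ := fun {x₀ Y} hY i =>
    mdifferentiableAt_localFrameCoeff b (he x₀) hY i
  -- At each `x` the formula uses the frame centred at `x`, with `Γ` in the role of the connection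
  -- coefficients. It is only evaluated at that centre, so nothing has to be patched, and it makes
  -- sense for arbitrary fields.
  let D : (Π x : M, TangentSpace (𝓡 n) x) →
      Π x : M, TangentSpace (𝓡 n) x →L[ℝ] TangentSpace (𝓡 n) x := fun Y x =>
    ∑ i, ((mvfderiv (𝓡 n) (c x i Y) x).smulRight ((e x).localFrame b i x) + c x i Y x • Γ x i)
  have hD : IsCovariantDerivativeOn (EuclideanSpace ℝ (Fin n)) D Set.univ := by
    refine ⟨fun {Y Z x} hY hZ _ => ?_, fun {Y a x} hY ha _ => ?_⟩
    · simp only [D]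
      rw [← Finset.sum_add_distrib]
      refine Finset.sum_congr rfl fun i _ => ?_
      have h1 : c x i (Y + Z) = c x i Y + c x i Z := funext fun y => map_add _ _ _
      rw [h1, mvfderiv_add (hc hY i) (hc hZ i), Pi.add_apply]
      ext v
      simp
      module
    · have h2 : Y x = ∑ i, c x i Y x • (e x).localFrame b i x :=
        (e x).eq_sum_localFrameCoeff_smul (I := 𝓡 n) (b := b) (s := Y) (he x)
      have h1 : ∀ i, c x i (a • Y) = a • c x i Y := fun i => funext fun y =>
        ((e x).localFrameCoeff (𝓡 n) b i y).map_smul (a y) (Y y)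
      ext v
      conv_rhs => rw [add_apply, ContinuousLinearMap.smulRight_apply, h2]
      simp only [D, h1]
      rw [smul_apply, sum_apply, sum_apply, Finset.smul_sum, Finset.smul_sum,
        ← Finset.sum_add_distrib]
      refine Finset.sum_congr rfl fun i _ => ?_
      rw [mvfderiv_smul ha (hc hY i)]
      simp
      module
  refine ⟨⟨D, hD⟩, fun f hf Y hY x => ?_⟩
  have hcut := fun i => cutoff_localFrameCoeff_isRealTest b (e x) (hψ x) (hψe x) hY.1 i
  -- Applying `N f` to the expansion of `ψ² Y` in the cut-off frame produces the formula defining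
  -- `D`, because `ψ` is one near `x` and contributes no derivative.
  have h1 := congrFun (congrArg (N f) (sum_cutoff_localFrame (n := n) b (e x) (hψe x) Y)) x
  have hψx := (hψ1 x).self_of_nhds
  have hd : mvfderiv (𝓡 n) (fun y => ψ x y * ψ x y) x = 0 := by
    have h3 : (fun y => ψ x y * ψ x y) =ᶠ[𝓝 x] fun _ => (1 : ℝ) := by
      filter_upwards [hψ1 x] with y hy
      rw [hy, one_mul]
    rw [mvfderiv_congr h3]
    simp [mvfderiv]
  rw [h.N_leibniz hf ((hψ x).mul (hψ x)) hY, hd, hψx] at h1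
  rw [h.N_sum hf _ _ fun i => smul_mem_testSections (hcut i).1 (hfr x i), Finset.sum_apply] at h1
  have h4 : N f Y x =
      ((0 : TangentSpace (𝓡 n) x →L[ℝ] ℝ) (H f x)) • Y x + (1 * 1 : ℝ) • N f Y x := by
    simp
  refine Eq.trans ?_ (h1.trans h4.symm)
  change D Y x (H f x) = _
  simp only [D]
  rw [sum_apply]
  refine Finset.sum_congr rfl fun i _ => ?_
  have h5 : mvfderiv (𝓡 n) (fun y => ψ x y * (e x).localFrameCoeff (𝓡 n) b i y (Y y)) x =
      mvfderiv (𝓡 n) (c x i Y) x := by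
    refine mvfderiv_congr ?_
    filter_upwards [hψ1 x] with y hy
    rw [hy, one_mul]
  rw [h.N_leibniz hf (hcut i) (hfr x i), h5, hψx, one_smul, one_mul, add_apply,
    ContinuousLinearMap.smulRight_apply, smul_apply, hΓ x i f hf]

end IsFlatHamiltonianConnection

end

/-! ### The extended connection is the Levi-Civita connection, and it is flat. -/

section

namespace IsFlatHamiltonianConnection

variable {n : ℕ} {M : Type*} [TopologicalSpace M]
  [ChartedSpace (EuclideanSpace ℝ (Fin n)) M] [IsManifold (𝓡 n) ∞ M] {g : RiemMetric n M}
  {H : (M → ℝ) → Π x : M, TangentSpace (𝓡 n) x} {br : (M → ℝ) → (M → ℝ) → M → ℝ}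
  {N : (M → ℝ) → (Π x : M, TangentSpace (𝓡 n) x) → Π x : M, TangentSpace (𝓡 n) x}

theorem _root_.IsSmoothSection.mdifferentiableAt {X : Π x : M, TangentSpace (𝓡 n) x}
    (hX : IsSmoothSection n (EuclideanSpace ℝ (Fin n)) X) (x : M) :
    MDifferentiableAt (𝓡 n) (𝓡 n).tangent (fun x => (X x : TangentBundle (𝓡 n) M)) x :=
  ContMDiff.mdifferentiable hX (by simp) x

variable {cov : CovariantDerivative (𝓡 n) (EuclideanSpace ℝ (Fin n))
    (fun x : M => TangentSpace (𝓡 n) x)}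

/-- The comparison with `N` concerns compactly supported fields; locality of a covariant derivative
extends it to all smooth fields after a cut-off. -/
theorem cov_eq (hcov : ∀ f, IsRealTest n f → ∀ Y ∈ testFields n M, ∀ x, cov Y x (H f x) = N f Y x)
    {f ψ : M → ℝ} {Y : Π x : M, TangentSpace (𝓡 n) x} {x : M} (hf : IsRealTest n f)
    (hψ : IsRealTest n ψ) (hY : IsSmoothSection n (EuclideanSpace ℝ (Fin n)) Y)
    (hψx : ∀ᶠ y in 𝓝 x, ψ y = 1) :
    cov Y x (H f x) = N f (fun y => ψ y • Y y) x := by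
  have hψY := hψ.smul_mem_testSections hY
  have h1 : cov Y x = cov (fun y => ψ y • Y y) x := by
    refine cov.isCovariantDerivativeOn.congr_of_eventuallyEq (hY.mdifferentiableAt x)
      (hψY.1.mdifferentiableAt x) Filter.univ_mem ?_
    filter_upwards [hψx] with y hy
    rw [hy, one_smul]
  rw [h1, hcov f hf _ hψY]

theorem torsion_eq_zero (h : IsFlatHamiltonianConnection g H br N)
    (hcov : ∀ f, IsRealTest n f → ∀ Y ∈ testFields n M, ∀ x, cov Y x (H f x) = N f Y x) :
    cov.torsion = 0 := by
  funext x
  refine ContinuousLinearMap.ext fun u => ContinuousLinearMap.ext fun v => ?_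
  obtain ⟨f, hf, rfl⟩ := h.exists_H_eq x u
  obtain ⟨k, hk, rfl⟩ := h.exists_H_eq x v
  have hfm := h.H_mem hf
  have hkm := h.H_mem hk
  rw [cov.torsion_apply (hfm.1.mdifferentiableAt x) (hkm.1.mdifferentiableAt x),
    hcov f hf _ hkm, hcov k hk _ hfm, ← h.H_br hf hk, ← h.torsion hf hk, Pi.sub_apply, sub_self]
  rfl

variable [T2Space M]

/-- By the criterion for homomorphism bundles it is enough to insert Hamiltonian fields, which
attain every tangent vector and on which the connection is the smooth `N`. -/
theorem isSmoothSection_cov (h : IsFlatHamiltonianConnection g H br N)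
    (hcov : ∀ f, IsRealTest n f → ∀ Y ∈ testFields n M, ∀ x, cov Y x (H f x) = N f Y x)
    {Y : Π x : M, TangentSpace (𝓡 n) x} (hY : IsSmoothSection n (EuclideanSpace ℝ (Fin n)) Y) :
    IsSmoothSection n (EuclideanSpace ℝ (Fin n) →L[ℝ] EuclideanSpace ℝ (Fin n))
      (V := fun x : M => TangentSpace (𝓡 n) x →L[ℝ] TangentSpace (𝓡 n) x) (cov Y) := by
  intro x₀
  refine contMDiffAt_hom_of_forall_exists (E₁ := fun x : M => TangentSpace (𝓡 n) x)
    (E₂ := fun x : M => TangentSpace (𝓡 n) x) (cov Y) fun v => ?_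
  obtain ⟨f, hf, hfx⟩ := h.exists_H_eq x₀ v
  obtain ⟨ψ, hψ, hψ1, -⟩ := exists_isRealTest_bump (n := n) (Filter.univ_mem : Set.univ ∈ 𝓝 x₀)
  refine ⟨H f, hfx, (h.H_mem hf).1 x₀, ?_⟩
  refine ((h.N_mem hf (hψ.smul_mem_testSections hY)).1 x₀).congr_of_eventuallyEq ?_
  -- The cut-off must equal one near each nearby `y`, and not only at `y`, because `cov_eq` is
  -- applied at `y`.
  filter_upwards [hψ1.eventually_nhds] with y hy
  exact congrArg _ (cov_eq hcov hf hψ hY hy)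

theorem metric_cov (h : IsFlatHamiltonianConnection g H br N)
    (hcov : ∀ f, IsRealTest n f → ∀ Y ∈ testFields n M, ∀ x, cov Y x (H f x) = N f Y x)
    {Y Z : Π x : M, TangentSpace (𝓡 n) x} (hY : IsSmoothSection n (EuclideanSpace ℝ (Fin n)) Y)
    (hZ : IsSmoothSection n (EuclideanSpace ℝ (Fin n)) Z) (x : M) (v : TangentSpace (𝓡 n) x) :
    mvfderiv (𝓡 n) (fun y => g.inner y (Y y) (Z y)) x v =
      g.inner x (cov Y x v) (Z x) + g.inner x (Y x) (cov Z x v) := by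
  obtain ⟨f, hf, rfl⟩ := h.exists_H_eq x v
  obtain ⟨ψ, hψ, hψ1, -⟩ := exists_isRealTest_bump (n := n) (Filter.univ_mem : Set.univ ∈ 𝓝 x)
  have h1 := h.metric hf (hψ.smul_mem_testSections hY) (hψ.smul_mem_testSections hZ) x
  have h2 : (fun y => g.inner y (ψ y • Y y) (ψ y • Z y)) =ᶠ[𝓝 x]
      fun y => g.inner y (Y y) (Z y) := by
    filter_upwards [hψ1] with y hy
    rw [hy, one_smul, one_smul]
  rw [mvfderiv_congr h2, hψ1.self_of_nhds, one_smul, one_smul] at h1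
  rw [h1, cov_eq hcov hf hψ hY hψ1, cov_eq hcov hf hψ hZ hψ1]

theorem curvature_eq_zero (h : IsFlatHamiltonianConnection g H br N)
    (hcov : ∀ f, IsRealTest n f → ∀ Y ∈ testFields n M, ∀ x, cov Y x (H f x) = N f Y x)
    {X Y Z : Π x : M, TangentSpace (𝓡 n) x}
    (hX : IsSmoothSection n (EuclideanSpace ℝ (Fin n)) X)
    (hY : IsSmoothSection n (EuclideanSpace ℝ (Fin n)) Y)
    (hZ : IsSmoothSection n (EuclideanSpace ℝ (Fin n)) Z) (x : M) :
    curvature cov X Y Z x = 0 := by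
  have hZc := isSmoothSection_cov h hcov hZ
  have hcZ : ∀ {X : Π x : M, TangentSpace (𝓡 n) x},
      MDifferentiableAt (𝓡 n) (𝓡 n).tangent (fun x => (X x : TangentBundle (𝓡 n) M)) x →
      MDifferentiableAt (𝓡 n) (𝓡 n).tangent
        (fun x => (cov Z x (X x) : TangentBundle (𝓡 n) M)) x := fun hX =>
    MDifferentiableAt.clm_bundle_apply (ContMDiff.mdifferentiable hZc (by simp) x) hX
  have hIC := cov.isCovariantDerivativeOn (s := Set.univ)
  obtain ⟨f, hf, hfx⟩ := h.exists_H_eq x (X x)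
  obtain ⟨k, hk, hkx⟩ := h.exists_H_eq x (Y x)
  -- Curvature is tensorial in its first two arguments, so they may be replaced by Hamiltonian
  -- fields with the same values at `x`.
  have hred : curvature cov X Y Z x = curvature cov (H f) (H k) Z x := by
    refine TensorialAt.pointwise₂ (I := 𝓡 n) (F := EuclideanSpace ℝ (Fin n))
      (F' := EuclideanSpace ℝ (Fin n)) (Φ := fun X Y => curvature cov X Y Z x)
      (fun Y hY => ⟨fun {a X} ha hX => ?_, fun {X X'} hX hX' => ?_⟩)
      (fun X hX => ⟨fun {a Y} ha hY => ?_, fun {Y Y'} hY hY' => ?_⟩)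
      (hX.mdifferentiableAt x) ((h.H_mem hf).1.mdifferentiableAt x)
      (hY.mdifferentiableAt x) ((h.H_mem hk).1.mdifferentiableAt x) hfx.symm hkx.symm
    · have h1 : (fun y => cov Z y ((a • X) y)) = a • fun y => cov Z y (X y) :=
        funext fun y => (cov Z y).map_smul (a y) (X y)
      simp only [curvature]
      rw [h1, hIC.leibniz (hcZ hX) ha, VectorField.mlieBracket_smul_left ha hX]
      simp
      module
    · have h1 : (fun y => cov Z y ((X + X') y)) =
          (fun y => cov Z y (X y)) + fun y => cov Z y (X' y) :=
        funext fun y => (cov Z y).map_add (X y) (X' y)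
      simp only [curvature]
      rw [h1, hIC.add (hcZ hX) (hcZ hX'), VectorField.mlieBracket_add_left hX hX']
      simp
      module
    · have h1 : (fun y => cov Z y ((a • Y) y)) = a • fun y => cov Z y (Y y) :=
        funext fun y => (cov Z y).map_smul (a y) (Y y)
      simp only [curvature]
      rw [h1, hIC.leibniz (hcZ hY) ha, VectorField.mlieBracket_smul_right ha hY]
      simp
      module
    · have h1 : (fun y => cov Z y ((Y + Y') y)) =
          (fun y => cov Z y (Y y)) + fun y => cov Z y (Y' y) :=
        funext fun y => (cov Z y).map_add (Y y) (Y' y)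
      simp only [curvature]
      rw [h1, hIC.add (hcZ hY) (hcZ hY'), VectorField.mlieBracket_add_right hY hY']
      simp
      module
  obtain ⟨ψ, hψ, hψ1, -⟩ := exists_isRealTest_bump (n := n) (Filter.univ_mem : Set.univ ∈ 𝓝 x)
  have hψZ := hψ.smul_mem_testSections hZ
  -- The inner derivative agrees with `N k (ψ Z)` on a whole neighbourhood of `x`, so it can be
  -- differentiated again.
  have hcc : ∀ f k, IsRealTest n f → IsRealTest n k →
      cov (fun y => cov Z y (H k y)) x (H f x) = N f (N k fun y => ψ y • Z y) x := by
    intro f k hf hk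
    have hNk := h.N_mem hk hψZ
    have h1 : cov (fun y => cov Z y (H k y)) x = cov (N k fun y => ψ y • Z y) x := by
      refine hIC.congr_of_eventuallyEq (hcZ ((h.H_mem hk).1.mdifferentiableAt x))
        (hNk.1.mdifferentiableAt x) Filter.univ_mem ?_
      filter_upwards [hψ1.eventually_nhds] with y hy
      exact cov_eq hcov hk hψ hZ hy
    rw [h1, hcov f hf _ hNk]
  rw [hred, curvature, hcc f k hf hk, hcc k f hk hf, ← h.H_br hf hk,
    cov_eq hcov (h.br_mem hf hk) hψ hZ hψ1, ← h.flat hf hk hψZ, Pi.sub_apply, sub_self]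

theorem isFlatMetric (h : IsFlatHamiltonianConnection g H br N) : IsFlatMetric g := by
  obtain ⟨cov, hcov'⟩ := h.exists_covariantDerivative
  have hcov : ∀ f, IsRealTest n f → ∀ Y ∈ testFields n M, ∀ x, cov Y x (H f x) = N f Y x := hcov'
  refine ⟨cov, ⟨⟨⟨fun {Y} hY => ?_⟩⟩, torsion_eq_zero h hcov,
    fun X Y Z _ hY hZ x => metric_cov h hcov hY hZ x (X x)⟩,
    fun X Y Z hX hY hZ x => curvature_eq_zero h hcov hX hY hZ x⟩
  have hY' : IsSmoothSection n (EuclideanSpace ℝ (Fin n)) Y := contMDiffOn_univ.1 hY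
  exact contMDiffOn_univ.2 (isSmoothSection_cov h hcov hY')

end IsFlatHamiltonianConnection

end

end

theorem mainTheorem7 {n : ℕ} {M : Type*} [TopologicalSpace M] [T2Space M]
    [ChartedSpace (EuclideanSpace ℝ (Fin n)) M] [IsManifold (𝓡 n) ∞ M] (g : RiemMetric n M)
    {F : Type*} [NormedAddCommGroup F] [NormedSpace ℂ F] [FiniteDimensional ℂ F] [Nontrivial F]
    {V : M → Type*} [TopologicalSpace (TotalSpace F V)] [∀ x, TopologicalSpace (V x)]
    [∀ x, AddCommGroup (V x)] [∀ x, Module ℂ (V x)] [FiberBundle F V]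
    [VectorBundle ℂ F V] [VectorBundle ℝ F V] [ContMDiffVectorBundle ∞ F V (𝓡 n)]
    {K A W : Type*} [CommRing K] [Algebra ℂ K]
    [NonUnitalRing A] [Module K A] [IsScalarTower K A A] [SMulCommClass K A A]
    [AddCommGroup W] [Module K W]
    (T : DeformedSpectralTriple g F V K A W)
    (P : BivectorField n M) (hP : T.deformation.IsPoissonField P)
    (Ω : TwoForm n M) (hΩ : Ω.IsInverseOf P) :
    ∃ g' : RiemMetric n M,
      (∀ (x : M) (u v : TangentSpace (𝓡 n) x),
        g'.inner x u v = cometric g x (Ω.toFun x u) (Ω.toFun x v)) ∧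
      IsFlatMetric g' := by
  -- Nonzero rank of the Spin bundle is used here: the metric identity is obtained by letting
  -- scalars act on spinors, so a nonvanishing spinor is needed at each point.
  have hV : ∀ x : M, ∃ s ∈ testSections n F V, s x ≠ 0 := fun x => by
    have : FiniteDimensional ℝ F := FiniteDimensional.complexToReal F
    have : Nontrivial (V x) :=
      ((trivializationAt F V x).linearEquivAt (R := ℝ) x
        (FiberBundle.mem_baseSet_trivializationAt' x)).toEquiv.nontrivial
    obtain ⟨v, hv⟩ := exists_ne (0 : V x)
    obtain ⟨s, hs, hsx⟩ := exists_mem_testSections_eq (n := n) (F := F) x v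
    exact ⟨s, hs, hsx ▸ hv⟩
  exact ⟨hΩ.metric g, Ω.transportInner_apply g,
    (T.isFlatHamiltonianConnection hV hP hΩ).isFlatMetric⟩
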